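/- Consider $n$-qubit stabilizer codes given by a list of commuting Pauli generators $G_1,\dots,G_r$. An operator is undetectable if it commutes with all generators, and the distance $d$ is the minimum weight of an undetectable Pauli operator that is not, up to a phase, in the stabilizer group ($d=\infty$ if there is none). A CSS code is one whose generators are each a product of only $X$ or only $Z$ operators. Error model. The generators are measured in $M\ge 1$ rounds. Before each measurement round every qubit is, independently, erased with probability $y$ (at a known location; it returns in a completely random state, i.e. with a uniformly random Pauli error), and otherwise suffers a Pauli error: in case (a) depolarizing, i.e. each of $X,Y,Z$ with probability $p/3$; in case (b) an $X$ error with probability $p_X$ and, independently, a $Z$ error with probability $p_Z$. Qubit errors accumulate. Every measured syndrome bit is, independently, flipped with probability $q$ without effect on the qubits, except that the last round is noiseless. A decoder sees the erasure locations and the measured syndromes of all rounds and returns a Pauli correction; it fails if the product of the correction and of the accumulated error is not in the stabilizer group up to a phase. We say that a sequence of codes achieves vanishing error rates if there are decoders (for each code and each $M$) such that the failure probability per round tends to zero uniformly in $M$, i.e. it is at most $M\delta_t$ for the $t$-th code, with $\delta_t\to0$ independent of $M$, and such that the total failure probability tends to zero for all numbers of rounds $M_t\ge 1$ with $M_t\le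 c\,d_t$, $c$ a constant. Theorem. Let $D>0$ and let $y,p,p_X,p_Z,q\in[0,1]$. Put $$\Upsilon(y,p)=y+(1-y)\Bigl\{\tfrac{2p}{3}+2\bigl[\tfrac p3(1-p)\bigr]^{1/2}\Bigr\},\qquad \Upsilon_{\rm CSS}(y,p)=y+2(1-y)[p(1-p)]^{1/2}.$$ (a) Any sequence of stabilizer codes with lengths $n\to\infty$, distances $d\ge D\ln n$ and generators of weight at most $w$ achieves vanishing error rates under erasures, depolarizing errors and syndrome measurement errors if $$4[q(1-q)]^{1/2}+2w\,\Upsilon(y,p)\le e^{-1/D}.$$ (b) Any sequence of CSS codes with lengths $n\to\infty$, distances $d\ge D\ln n$ and $X$-type and $Z$-type generators of weights at most $w_X$ and $w_Z$ achieves vanishing error rates under erasures, independent $X/Z$ errors and syndrome measurement errors if $$4[q(1-q)]^{1/2}+w_X\Upsilon_{\rm CSS}(y,p_Z)\le e^{-1/D}\quad\text{and}\quad 4[q(1-q)]^{1/2}+w_Z\Upsilon_{\rm CSS}(y,p_X)\le e^{-1/D}.$$ -/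

import Mathlib

open Filter Topology
open scoped ENNReal

/-- `n`-qubit Pauli operators modulo phase in the binary representation: the entry `(v, u)` at
a qubit stands for `X ^ v * Z ^ u`.  Addition is the product of operators modulo phase. -/
abbrev PauliString (n : ℕ) : Type := Fin n → ZMod 2 × ZMod 2

/-- Weight of a Pauli operator: the number of its non-identity tensor factors. -/
def pauliWeight {n : ℕ} (E : PauliString n) : ℕ := hammingNorm E

/-- The commutation bit of two Pauli operators: `0` if they commute, `1` if they anticommute. -/
def commBit {n : ℕ} (E F : PauliString n) : ZMod 2 :=
  ∑ k, ((E k).1 * (F k).2 + (E k).2 * (F k).1)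

/-- A stabilizer code on `n` qubits, given by a list (indexed by `ι`) of pairwise commuting
Pauli operators, the stabilizer generators that are measured.  The signs of the generators are
irrelevant for error correction and are dropped; dependent generators are allowed. -/
structure StabilizerCode (n : ℕ) (ι : Type) where
  gen : ι → PauliString n
  commute : ∀ i j, commBit (gen i) (gen j) = 0

namespace StabilizerCode

variable {n : ℕ} {ι : Type}

/-- The stabilizer group modulo phases. -/
def stabilizer (C : StabilizerCode n ι) : AddSubgroup (PauliString n) :=
  AddSubgroup.closure (Set.range C.gen)

/-- The syndrome of a Pauli error. -/
def syndrome (C : StabilizerCode n ι) (E : PauliString n) : ι → ZMod 2 :=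
  fun j => commBit (C.gen j) E

/-- The code distance: the minimum weight of an undetectable Pauli operator that is not in the
stabilizer (`⊤` if there is none). -/
noncomputable def distance (C : StabilizerCode n ι) : ℕ∞ :=
  ⨅ E ∈ {E : PauliString n | C.syndrome E = 0 ∧ E ∉ C.stabilizer}, (pauliWeight E : ℕ∞)

end StabilizerCode

/-- A CSS code: `X`-type generators `genX` and `Z`-type generators `genZ` with
`genX * genZᵀ = 0` modulo 2. -/
structure CSSCode (n rX rZ : ℕ) where
  genX : Fin rX → Fin n → ZMod 2
  genZ : Fin rZ → Fin n → ZMod 2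
  orthogonal : ∀ i j, ∑ k, genX i k * genZ j k = 0

/-- The stabilizer code of a CSS code. -/
def CSSCode.toStabilizerCode {n rX rZ : ℕ} (C : CSSCode n rX rZ) :
    StabilizerCode n (Fin rX ⊕ Fin rZ) where
  gen := Sum.elim (fun i k => (C.genX i k, 0)) (fun j k => (0, C.genZ j k))
  commute := by
    rintro (i | i) (j | j)
    · simp [commBit]
    · simpa [commBit] using C.orthogonal i j
    · simpa [commBit, mul_comm] using C.orthogonal j i
    · simp [commBit]

/-- Probability of a bit (being flipped or not) when a flip has probability `q`. -/
noncomputable def flipProb (q : ℝ) (b : ZMod 2) : ℝ := if b = 0 then 1 - q else q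

/-- Depolarizing noise on one qubit: each of `X`, `Y`, `Z` has probability `p / 3`. -/
noncomputable def depolarizing (p : ℝ) (e : ZMod 2 × ZMod 2) : ℝ :=
  if e = 0 then 1 - p else p / 3

/-- Independent `X` and `Z` errors on one qubit. -/
noncomputable def independentXZ (pX pZ : ℝ) (e : ZMod 2 × ZMod 2) : ℝ :=
  flipProb pX e.1 * flipProb pZ e.2

/-- One qubit in one round: `(true, e)` means that it is erased (probability `y`, at a known
location, and it returns in a completely random state: a uniformly random Pauli error `e`);
`(false, e)` means that it is not erased and suffers the Pauli error `e`, distributed by `π`. -/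
noncomputable def qubitProb (y : ℝ) (π : ZMod 2 × ZMod 2 → ℝ) (a : Bool × (ZMod 2 × ZMod 2)) :
    ℝ :=
  if a.1 = true then y * (1 / 4) else (1 - y) * π a.2

/-- What happens to the qubits in `M` rounds: for each round (before the measurement) and each
qubit, the erasure flag and the Pauli error. -/
abbrev QubitHistory (n M : ℕ) : Type := Fin M → Fin n → Bool × (ZMod 2 × ZMod 2)

/-- The Pauli error of one round. -/
def roundError {n M : ℕ} (h : QubitHistory n M) (i : Fin M) : PauliString n :=
  fun k => (h i k).2

/-- The erasure locations, which are known to the decoder. -/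
def erasures {n M : ℕ} (h : QubitHistory n M) : Fin M → Fin n → Bool :=
  fun i k => (h i k).1

/-- The net Pauli error accumulated during all rounds. -/
def netError {n M : ℕ} (h : QubitHistory n M) : PauliString n := ∑ i, roundError h i

/-- The measured syndromes.  Round `i` yields the syndrome of the error accumulated in the rounds
up to `i`, with the measurement error `ε i` added.  The last round has no measurement error (such
errors are assigned to the subsequent cycle). -/
def measuredSyndromes {n M : ℕ} {ι : Type} (C : StabilizerCode n ι) (h : QubitHistory n M)
    (ε : Fin (M - 1) → ι → ZMod 2) : Fin M → ι → ZMod 2 :=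
  fun i => C.syndrome (∑ j ∈ Finset.Iic i, roundError h j) +
    (if hi : (i : ℕ) < M - 1 then ε ⟨i, hi⟩ else 0)

/-- A decoder for `M` rounds: it sees the erasure locations and the measured syndromes of all
rounds and returns a Pauli correction. -/
abbrev Decoder (n : ℕ) (ι : Type) (M : ℕ) : Type :=
  (Fin M → Fin n → Bool) → (Fin M → ι → ZMod 2) → PauliString n

open Classical in
/-- The probability that decoding of `M` rounds fails, that is, that the product of the correction
and of the net error is not in the stabilizer.  All qubits in all rounds are independent with
distribution `qubitProb y π`, and all syndrome measurement errors are independent with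
probability `q`. -/
noncomputable def failureProb {n : ℕ} {ι : Type} [Fintype ι] [DecidableEq ι]
    (C : StabilizerCode n ι) (y : ℝ) (π : ZMod 2 × ZMod 2 → ℝ) (q : ℝ) (M : ℕ)
    (dec : Decoder n ι M) : ℝ :=
  ∑ h : QubitHistory n M, ∑ ε : Fin (M - 1) → ι → ZMod 2,
    (∏ i, ∏ k, qubitProb y π (h i k)) * (∏ i, ∏ j, flipProb q (ε i j)) *
      (if dec (erasures h) (measuredSyndromes C h ε) + netError h ∈ C.stabilizer then 0 else 1)

/-- Vanishing error rates for a sequence of codes under repeated noisy syndrome measurement: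
there are decoders such that the failure probability per measurement round tends to zero uniformly
in the number of rounds, and such that the total failure probability tends to zero whenever
the number of rounds is at most proportional to the code distance. -/
def VanishingErrorRates {n : ℕ → ℕ} {ι : ℕ → Type} [∀ t, Fintype (ι t)]
    [∀ t, DecidableEq (ι t)] (C : ∀ t, StabilizerCode (n t) (ι t))
    (y : ℝ) (π : ZMod 2 × ZMod 2 → ℝ) (q : ℝ) : Prop :=
  ∃ dec : ∀ t M, Decoder (n t) (ι t) M,
    (∃ δ : ℕ → ℝ, Tendsto δ atTop (𝓝 0) ∧
      ∀ t M, 1 ≤ M → failureProb (C t) y π q M (dec t M) ≤ M * δ t) ∧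
    ∀ (c : ℕ) (M : ℕ → ℕ), (∀ t, 1 ≤ M t ∧ (M t : ℕ∞) ≤ c * (C t).distance) →
      Tendsto (fun t => failureProb (C t) y π q (M t) (dec t (M t))) atTop (𝓝 0)

/-- The effective erasure probability for erasures and depolarizing errors. -/
noncomputable def Upsilon (y p : ℝ) : ℝ :=
  y + (1 - y) * (2 * p / 3 + 2 * √(p / 3 * (1 - p)))

/-- The effective erasure probability for erasures and independent `X` (or `Z`) errors. -/
noncomputable def UpsilonCSS (y p : ℝ) : ℝ := y + 2 * (1 - y) * √(p * (1 - p))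

/-! The decoder returns the most likely error compatible with the erasures and the measured
syndromes. If it fails on an error `a`, then adding some undetectable pattern `g` with nontrivial
net effect gives an error at least as likely as `a`, and `g` can be chosen irreducible
(`exists_irreducible_prod_le`). Since `P a ≤ √(P a * P (a + g))` for such a `g`, the failure
probability is at most the sum over all such `g` of a product of Bhattacharyya parameters, one per
site (`exists_decoder_failure_le`).

This sum is estimated by growing `g` site by site (`sum_irreducibleExtensions_le`). A partial
pattern that is not yet undetectable violates some check, and the next site must be taken from that
check. If the parameters of all errors seen by a check sum to at most `Q`, the choices weigh at most
`Q - η`, because an occupied site of that check, of weight at least `η`, is no longer available.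
Irreducibility stops the growth as soon as the pattern is undetectable.

Repeated measurement fits this scheme: the change of a syndrome bit between consecutive rounds
involves the qubits of one round and at most two measurement errors. Hence `Q` is `4 * √(q * (1 -
q))` plus the contribution of one generator. Nontrivial patterns have at least `d` sites and contain
a qubit site, so the failure probability is at most a constant times `M * n * (Q - η) ^ d`. With `Q
= exp (-1 / D)` and `d ≥ D ln n` one has `n * Q ^ d ≤ 1`, and the remaining factor `((Q - η) / Q) ^
d` tends to zero. The gain `η` is what allows equality in the threshold condition. -/

/-! ### Irreducible patterns and maximum likelihood decoding -/

section Irreducible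

variable {V : Type*} [Fintype V] [DecidableEq V] {A : V → Type*} [∀ v, AddCommGroup (A v)]

/-- A pattern in `K` is irreducible if none of its restrictions to a set of positions is in `K`,
apart from `0` and the pattern itself. -/
def IsIrreduciblePattern (K : AddSubgroup (∀ v, A v)) (g : ∀ v, A v) : Prop :=
  g ∈ K ∧ ∀ S : Finset V, S.piecewise g 0 ∈ K → S.piecewise g 0 = 0 ∨ S.piecewise g 0 = g

/-- Choose `S` of minimal size among the restrictions in `K` outside `T`. If a further restriction
lies in `K`, so does the complementary one. The two add up to an element outside `T`, so at least
one of them is outside `T`, and by minimality it is the whole pattern. -/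
theorem exists_irreducible_restriction (K T : AddSubgroup (∀ v, A v)) {f : ∀ v, A v}
    (hf : f ∈ K) (hfT : f ∉ T) :
    ∃ S : Finset V, S.piecewise f 0 ∉ T ∧ IsIrreduciblePattern K (S.piecewise f 0) := by
  classical
  obtain ⟨S, hS, hmin⟩ := Finset.exists_min_image
    (Finset.univ.filter fun S : Finset V => S.piecewise f 0 ∈ K ∧ S.piecewise f 0 ∉ T)
    Finset.card ⟨Finset.univ, by simpa using ⟨hf, hfT⟩⟩
  simp only [Finset.mem_filter, Finset.mem_univ, true_and] at hS hmin
  refine ⟨S, hS.2, hS.1, fun S' hS' => ?_⟩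
  have h1 : S'.piecewise (S.piecewise f 0) 0 = (S ∩ S').piecewise f 0 := by
    ext v
    by_cases h : v ∈ S <;> by_cases h' : v ∈ S' <;> simp [Finset.piecewise, h, h']
  have h2 : S.piecewise f 0 = (S ∩ S').piecewise f 0 + (S \ S').piecewise f 0 := by
    ext v
    by_cases h : v ∈ S <;> by_cases h' : v ∈ S' <;> simp [Finset.piecewise, h, h']
  rw [h1] at hS' ⊢
  by_cases hT : (S ∩ S').piecewise f 0 ∈ T
  · left
    have h3 : (S \ S').piecewise f 0 ∈ K := by
      have := K.sub_mem hS.1 hS'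
      rwa [h2, add_sub_cancel_left] at this
    have h4 : (S \ S').piecewise f 0 ∉ T := fun h => hS.2 (h2 ▸ T.add_mem hT h)
    have h5 := Finset.eq_of_subset_of_card_le Finset.sdiff_subset (hmin _ ⟨h3, h4⟩)
    have h6 : S ∩ S' = ∅ := by
      rw [← Finset.disjoint_iff_inter_eq_empty]
      exact Finset.sdiff_eq_self_iff_disjoint.1 h5
    rw [h6, Finset.piecewise_empty]
  · right
    rw [Finset.eq_of_subset_of_card_le Finset.inter_subset_left (hmin _ ⟨hS', hT⟩)]

/-- The Bhattacharyya parameter of a weight `ρ` and its translate by `g`. -/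
noncomputable def overlap {B : Type*} [Fintype B] [Add B] (ρ : B → ℝ) (g : B) : ℝ :=
  ∑ a, √(ρ a * ρ (a + g))

theorem overlap_nonneg {B : Type*} [Fintype B] [Add B] (ρ : B → ℝ) (g : B) : 0 ≤ overlap ρ g :=
  Finset.sum_nonneg fun _ _ => Real.sqrt_nonneg _

theorem overlap_zero {B : Type*} [Fintype B] [AddZeroClass B] {ρ : B → ℝ} (hρ : ∀ a, 0 ≤ ρ a) :
    overlap ρ 0 = ∑ a, ρ a := by
  simp [overlap, Real.sqrt_mul_self, hρ]

/-- If `e'` is at least as likely as all patterns that differ from it by an element of `K`, and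
`e' - a ∈ K` is not in `T`, then some irreducible pattern `g` outside `T` makes
`a + g` at least as likely as `a`. -/
theorem exists_irreducible_prod_le (K T : AddSubgroup (∀ v, A v)) {ρ : ∀ v, A v → ℝ}
    (hρ : ∀ v a, 0 ≤ ρ v a) {a e' : ∀ v, A v} (ha : 0 < ∏ v, ρ v (a v)) (hK : e' - a ∈ K)
    (hT : e' - a ∉ T) (hmax : ∀ g ∈ K, ∏ v, ρ v ((e' - g) v) ≤ ∏ v, ρ v (e' v)) :
    ∃ g, IsIrreduciblePattern K g ∧ g ∉ T ∧ ∏ v, ρ v (a v) ≤ ∏ v, ρ v ((a + g) v) := by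
  obtain ⟨S, hST, hirr⟩ := exists_irreducible_restriction K T hK hT
  refine ⟨_, hirr, hST, ?_⟩
  have h1 := hmax _ hirr.1
  have hpos : 0 < ∏ v, ρ v (e' v) := by
    have := hmax _ hK
    rw [sub_sub_cancel] at this
    exact ha.trans_le this
  have hpos' : ∀ v, 0 < ρ v (e' v) := fun v =>
    (hρ v _).lt_of_ne fun h => hpos.ne' (Finset.prod_eq_zero (Finset.mem_univ v) h.symm)
  -- Let `g` be the restriction of `e' - a` to `S`. Off `S`, `e' - g` agrees with `e'`, and these
  -- positive factors cancel; on `S`, `e' - g` agrees with `a` and `a + g` with `e'`. What remains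
  -- compares `a` with `a + g` on `S`, and off `S` these two agree.
  rw [← Finset.prod_mul_prod_compl S, ← Finset.prod_mul_prod_compl S] at h1
  have e1 : ∏ v ∈ S, ρ v ((e' - S.piecewise (e' - a) 0) v) = ∏ v ∈ S, ρ v (a v) :=
    Finset.prod_congr rfl fun v hv => by simp [hv]
  have e2 : ∏ v ∈ Sᶜ, ρ v ((e' - S.piecewise (e' - a) 0) v) = ∏ v ∈ Sᶜ, ρ v (e' v) :=
    Finset.prod_congr rfl fun v hv => by simp [Finset.mem_compl.1 hv]
  rw [e1, e2] at h1
  have h2 := le_of_mul_le_mul_right h1 (Finset.prod_pos fun v _ => hpos' v)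
  rw [← Finset.prod_mul_prod_compl S, ← Finset.prod_mul_prod_compl S]
  have e3 : ∏ v ∈ S, ρ v ((a + S.piecewise (e' - a) 0) v) = ∏ v ∈ S, ρ v (e' v) :=
    Finset.prod_congr rfl fun v hv => by simp [hv]
  have e4 : ∏ v ∈ Sᶜ, ρ v ((a + S.piecewise (e' - a) 0) v) = ∏ v ∈ Sᶜ, ρ v (a v) :=
    Finset.prod_congr rfl fun v hv => by simp [Finset.mem_compl.1 hv]
  rw [e3, e4]
  exact mul_le_mul_of_nonneg_right h2 (Finset.prod_nonneg fun v _ => hρ v _)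

theorem Real.sqrt_prod_univ {ι : Type*} [Fintype ι] {f : ι → ℝ} (hf : ∀ i, 0 ≤ f i) :
    √(∏ i, f i) = ∏ i, √(f i) := by
  rw [Real.sqrt_eq_iff_mul_self_eq (Finset.prod_nonneg fun i _ => hf i)
    (Finset.prod_nonneg fun i _ => Real.sqrt_nonneg _), ← Finset.prod_mul_distrib]
  exact Finset.prod_congr rfl fun i _ => (Real.mul_self_sqrt (hf i)).symm

variable [∀ v, Fintype (A v)]

open Classical in
/-- The union bound over irreducible patterns for maximum likelihood decoding. -/
theorem exists_decoder_failure_le {Z : Type*} [AddCommGroup Z] (L : (∀ v, A v) →+ Z)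
    (T : AddSubgroup (∀ v, A v)) {ρ : ∀ v, A v → ℝ} (hρ : ∀ v a, 0 ≤ ρ v a) :
    ∃ δ : Z → ∀ v, A v,
      ∑ a : ∀ v, A v, (∏ v, ρ v (a v)) * (if δ (L a) - a ∈ T then 0 else 1) ≤
        ∑ g with IsIrreduciblePattern L.ker g ∧ g ∉ T, ∏ v, overlap (ρ v) (g v) := by
  -- The decoder picks a most likely pattern with the observed value `z`; values that never occur
  -- are sent to `0`.
  have hδ : ∀ z : Z, ∃ e : ∀ v, A v, ∀ a, L a = z →
      L e = z ∧ ∏ v, ρ v (a v) ≤ ∏ v, ρ v (e v) := by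
    intro z
    by_cases h : ∃ a, L a = z
    · obtain ⟨e, he, hmax⟩ := Finset.exists_max_image (Finset.univ.filter fun a => L a = z)
        (fun a => ∏ v, ρ v (a v)) (by simpa [Finset.Nonempty] using h)
      exact ⟨e, fun a ha => ⟨by simpa using he, hmax a (by simpa using ha)⟩⟩
    · exact ⟨0, fun a ha => (h ⟨a, ha⟩).elim⟩
  choose δ hδ using hδ
  refine ⟨δ, ?_⟩
  -- A failure at `a` yields a `g` with `P a ≤ P (a + g)`, hence `P a ≤ √(P a * P (a + g))`.
  -- Bounding by the sum over all `g` removes the dependence of `g` on `a`, so that the later sum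
  -- over `a` factorizes into overlaps.
  have key : ∀ a : ∀ v, A v, (∏ v, ρ v (a v)) * (if δ (L a) - a ∈ T then 0 else 1) ≤
      ∑ g with IsIrreduciblePattern L.ker g ∧ g ∉ T, ∏ v, √(ρ v (a v) * ρ v (a v + g v)) := by
    intro a
    have hnn : 0 ≤ ∑ g with IsIrreduciblePattern L.ker g ∧ g ∉ T,
        ∏ v, √(ρ v (a v) * ρ v (a v + g v)) :=
      Finset.sum_nonneg fun g _ => Finset.prod_nonneg fun v _ => Real.sqrt_nonneg _
    split_ifs with hT
    · simpa using hnn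
    · rcases (Finset.prod_nonneg fun v _ => hρ v (a v) : 0 ≤ ∏ v, ρ v (a v)).eq_or_lt with h0 | h0
      · simpa [← h0] using hnn
      · obtain ⟨g, hg, hgT, hle⟩ := exists_irreducible_prod_le L.ker T hρ h0 (e' := δ (L a))
          (by simp [AddMonoidHom.mem_ker, (hδ _ a rfl).1]) hT (fun g hg => by
            have h1 : L (δ (L a) - g) = L a := by
              rw [map_sub, (hδ _ a rfl).1, AddMonoidHom.mem_ker.1 hg, sub_zero]
            exact (hδ _ _ h1).2)
        rw [mul_one]
        refine le_trans ?_ (Finset.single_le_sum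
          (f := fun g : ∀ v, A v => ∏ v, √(ρ v (a v) * ρ v (a v + g v)))
          (fun g _ => Finset.prod_nonneg fun v _ => Real.sqrt_nonneg _)
          (Finset.mem_filter.2 ⟨Finset.mem_univ g, hg, hgT⟩))
        rw [← Real.sqrt_prod_univ fun v => mul_nonneg (hρ _ _) (hρ _ _),
          Finset.prod_mul_distrib]
        exact Real.le_sqrt_of_sq_le (by
          rw [sq]; exact mul_le_mul_of_nonneg_left hle h0.le)
  refine (Finset.sum_le_sum fun a _ => key a).trans ?_
  rw [Finset.sum_comm]
  refine Finset.sum_le_sum fun g _ => ?_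
  simp only [overlap]
  rw [Finset.prod_univ_sum]
  simp

end Irreducible

/-! ### Counting irreducible patterns by growth along violated checks -/

theorem sum_biUnion_le_sum_sum {α β : Type*} [DecidableEq β] (s : Finset α) (t : α → Finset β)
    {f : β → ℝ} (hf : ∀ b, 0 ≤ f b) : ∑ b ∈ s.biUnion t, f b ≤ ∑ a ∈ s, ∑ b ∈ t a, f b := by
  classical
  induction s using Finset.induction_on with
  | empty => simp
  | insert a s ha ih =>
    rw [Finset.biUnion_insert, Finset.sum_insert ha]
    have h1 := Finset.sum_union_inter (s₁ := t a) (s₂ := s.biUnion t) (f := f)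
    have h2 : 0 ≤ ∑ b ∈ t a ∩ s.biUnion t, f b := Finset.sum_nonneg fun b _ => hf b
    linarith

section Counting

variable {V : Type*} [Fintype V] [DecidableEq V] {A : V → Type*} [∀ v, AddCommGroup (A v)]
  [∀ v, Fintype (A v)] [∀ v, DecidableEq (A v)] {J : Type*}

/-- The set of positions at which a pattern is nonzero. -/
def patternSupport (g : ∀ v, A v) : Finset V := Finset.univ.filter fun v => g v ≠ 0

omit [DecidableEq V] [(v : V) → Fintype (A v)] in
theorem mem_patternSupport {g : ∀ v, A v} {v : V} : v ∈ patternSupport g ↔ g v ≠ 0 := by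
  simp [patternSupport]

omit [(v : V) → Fintype (A v)] in
theorem card_patternSupport_update {f : ∀ v, A v} {v : V} (hv : f v = 0) {a : A v} (ha : a ≠ 0) :
    (patternSupport (Function.update f v a)).card = (patternSupport f).card + 1 := by
  have : patternSupport (Function.update f v a) = insert v (patternSupport f) := by
    ext w
    rw [Finset.mem_insert, mem_patternSupport, mem_patternSupport]
    by_cases h : w = v
    · subst h; simp [ha]
    · simp [h]
  rw [this, Finset.card_insert_of_notMem (by simp [mem_patternSupport, hv])]

omit [(v : V) → Fintype (A v)] [(v : V) → DecidableEq (A v)] in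
theorem prod_update_of_eq_zero {u : ∀ v, A v → ℝ} (hu0 : ∀ v, u v 0 = 1) {f : ∀ v, A v} {v : V}
    (hv : f v = 0) (a : A v) :
    ∏ w, u w (Function.update f v a w) = (∏ w, u w (f w)) * u v a := by
  rw [← Finset.mul_prod_erase _ _ (Finset.mem_univ v),
    ← Finset.mul_prod_erase _ (fun w => u w (f w)) (Finset.mem_univ v), hv, hu0,
    Function.update_self, one_mul, mul_comm]
  congr 1
  exact Finset.prod_congr rfl fun w hw => by rw [Function.update_of_ne (Finset.ne_of_mem_erase hw)]

open Classical in
/-- The irreducible patterns that extend `f` by exactly `m` positions. -/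
noncomputable def irreducibleExtensions (K : AddSubgroup (∀ v, A v)) (f : ∀ v, A v) (m : ℕ) :
    Finset (∀ v, A v) :=
  Finset.univ.filter fun g => IsIrreduciblePattern K g ∧ (∀ v, f v = 0 ∨ g v = f v) ∧
    (patternSupport g).card = (patternSupport f).card + m

theorem mem_irreducibleExtensions {K : AddSubgroup (∀ v, A v)} {f g : ∀ v, A v} {m : ℕ} :
    g ∈ irreducibleExtensions K f m ↔ IsIrreduciblePattern K g ∧ (∀ v, f v = 0 ∨ g v = f v) ∧
      (patternSupport g).card = (patternSupport f).card + m := by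
  simp [irreducibleExtensions]

omit [DecidableEq V] [(v : V) → Fintype (A v)] in
theorem eq_of_extension_of_card {f g : ∀ v, A v} (h : ∀ v, f v = 0 ∨ g v = f v)
    (hc : (patternSupport g).card = (patternSupport f).card) : g = f := by
  have hsub : patternSupport f ⊆ patternSupport g := fun v hv => by
    rw [mem_patternSupport] at hv ⊢
    rwa [(h v).resolve_left hv]
  have heq := Finset.eq_of_subset_of_card_le hsub hc.le
  ext v
  rcases h v with h | h
  · have : v ∉ patternSupport g := by rw [← heq, mem_patternSupport]; simpa using h
    rw [mem_patternSupport, not_not] at this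
    rw [this, h]
  · exact h

variable {K : AddSubgroup (∀ v, A v)} {χ : J → ∀ v, A v →+ ZMod 2}

/-- The extension satisfies check `j` but `f` does not, so their contributions to this check differ
at some position. There `f` must vanish, and adding the value of the extension to `f` leaves `m`
positions to be filled. -/
theorem irreducibleExtensions_succ_subset {f : ∀ v, A v}
    (hK : ∀ g, g ∈ K ↔ ∀ j, ∑ v, χ j v (g v) = 0) {j : J} (hj : ∑ v, χ j v (f v) ≠ 0) (m : ℕ) :
    irreducibleExtensions K f (m + 1) ⊆
      (Finset.univ.filter fun x : Σ v, A v => f x.1 = 0 ∧ χ j x.1 x.2 ≠ 0).biUnion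
        fun x => irreducibleExtensions K (Function.update f x.1 x.2) m := by
  intro g hg
  rw [mem_irreducibleExtensions] at hg
  obtain ⟨hirr, hext, hcard⟩ := hg
  have hgj := (hK g).1 hirr.1 j
  have : ∃ v, χ j v (g v) ≠ χ j v (f v) := by
    by_contra! h
    exact hj (by rw [← hgj]; exact Finset.sum_congr rfl fun v _ => (h v).symm)
  obtain ⟨v, hv⟩ := this
  have hfv : f v = 0 := (hext v).resolve_right fun h => hv (by rw [h])
  have hχ : χ j v (g v) ≠ 0 := by simpa [hfv] using hv
  have hgv : g v ≠ 0 := fun h => hχ (by rw [h, map_zero])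
  rw [Finset.mem_biUnion]
  refine ⟨⟨v, g v⟩, by simpa using ⟨hfv, hχ⟩, ?_⟩
  rw [mem_irreducibleExtensions, card_patternSupport_update hfv hgv]
  refine ⟨hirr, fun w => ?_, by omega⟩
  by_cases h : w = v
  · subst h; simp
  · simpa [h] using hext w

/-- Each new position costs a factor `Q - η`: it is chosen so as to repair a violated check, whose
total weight is at most `Q`, and a position of `f` already uses up at least `η` of it. Once `f` is
in `K`, it is a nonzero restriction of every extension, so irreducibility excludes proper
extensions. -/
theorem sum_irreducibleExtensions_le {u : ∀ v, A v → ℝ} (hu : ∀ v a, 0 ≤ u v a)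
    (hu0 : ∀ v, u v 0 = 1) {Q η : ℝ}
    (hη : ∀ v a, a ≠ 0 → u v a = 0 ∨ η ≤ u v a) (hQη : η ≤ Q)
    (hK : ∀ g, g ∈ K ↔ ∀ j, ∑ v, χ j v (g v) = 0)
    (hQ : ∀ j, ∑ x : Σ v, A v with χ j x.1 x.2 ≠ 0, u x.1 x.2 ≤ Q) (m : ℕ) :
    ∀ f : ∀ v, A v, f ≠ 0 →
      ∑ g ∈ irreducibleExtensions K f m, ∏ v, u v (g v) ≤ (∏ v, u v (f v)) * (Q - η) ^ m := by
  classical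
  induction m with
  | zero =>
    intro f _
    have hsub : irreducibleExtensions K f 0 ⊆ {f} := fun g hg => by
      rw [mem_irreducibleExtensions] at hg
      exact Finset.mem_singleton.2 (eq_of_extension_of_card hg.2.1 hg.2.2)
    refine (Finset.sum_le_sum_of_subset_of_nonneg hsub
      fun g _ _ => Finset.prod_nonneg fun v _ => hu v _).trans ?_
    simp
  | succ m ih =>
    intro f hf
    have hnn : 0 ≤ ∏ v, u v (f v) := Finset.prod_nonneg fun v _ => hu v _
    by_cases hfK : f ∈ K
    · rw [Finset.sum_eq_zero]
      · exact mul_nonneg hnn (pow_nonneg (sub_nonneg.2 hQη) _)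
      · intro g hg
        exfalso
        rw [mem_irreducibleExtensions] at hg
        obtain ⟨hirr, hext, hcard⟩ := hg
        have h1 : (patternSupport f).piecewise g 0 = f := by
          ext v
          by_cases h : f v = 0
          · simp [Finset.piecewise, mem_patternSupport, h]
          · simp [Finset.piecewise, mem_patternSupport, h, (hext v).resolve_left h]
        rcases hirr.2 (patternSupport f) (h1.symm ▸ hfK) with h | h
        · exact hf (h1 ▸ h)
        · rw [h1] at h
          rw [h] at hcard
          omega
    · have : ∃ j, ∑ v, χ j v (f v) ≠ 0 := by
        by_contra! h
        exact hfK ((hK f).2 h)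
      obtain ⟨j, hj⟩ := this
      -- If `f` has weight zero, so do all its extensions. Otherwise all its nonzero entries have
      -- positive weight, hence weight at least `η`.
      rcases hnn.eq_or_lt with h0 | hpos
      · obtain ⟨v, -, hv⟩ := Finset.prod_eq_zero_iff.1 h0.symm
        have hfv : f v ≠ 0 := fun h => by simp [h, hu0] at hv
        rw [← h0, zero_mul]
        refine (Finset.sum_eq_zero fun g hg => ?_).le
        rw [mem_irreducibleExtensions] at hg
        exact Finset.prod_eq_zero (Finset.mem_univ v)
          (by rw [(hg.2.1 v).resolve_left hfv, hv])
      · obtain ⟨v₀, -, hv₀⟩ := Finset.exists_ne_zero_of_sum_ne_zero hj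
        have hfv₀ : f v₀ ≠ 0 := fun h => hv₀ (by rw [h, map_zero])
        have huv₀ : η ≤ u v₀ (f v₀) := (hη v₀ _ hfv₀).resolve_left fun h =>
          hpos.ne' (Finset.prod_eq_zero (Finset.mem_univ v₀) h)
        set N := Finset.univ.filter fun x : Σ v, A v => f x.1 = 0 ∧ χ j x.1 x.2 ≠ 0 with hN
        have hNQ : ∑ x ∈ N, u x.1 x.2 ≤ Q - η := by
          -- The entry of `f` at `v₀` counts towards the weight of check `j` but is not among the
          -- choices `N`, which live on unoccupied positions.
          have hnot : (⟨v₀, f v₀⟩ : Σ v, A v) ∉ N := by simp [hN, hfv₀]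
          have hsub : insert (⟨v₀, f v₀⟩ : Σ v, A v) N ⊆
              Finset.univ.filter fun x : Σ v, A v => χ j x.1 x.2 ≠ 0 := by
            intro x hx
            rcases Finset.mem_insert.1 hx with rfl | hx
            · simpa using hv₀
            · simp only [hN, Finset.mem_filter] at hx
              simpa using hx.2.2
          have h1 := (Finset.sum_le_sum_of_subset_of_nonneg hsub
            (f := fun x => u x.1 x.2) fun x _ _ => hu _ _).trans (hQ j)
          rw [Finset.sum_insert hnot] at h1
          linarith
        calc ∑ g ∈ irreducibleExtensions K f (m + 1), ∏ v, u v (g v)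
            ≤ ∑ g ∈ N.biUnion fun x => irreducibleExtensions K (Function.update f x.1 x.2) m,
                ∏ v, u v (g v) :=
              Finset.sum_le_sum_of_subset_of_nonneg
                (irreducibleExtensions_succ_subset hK hj m)
                fun g _ _ => Finset.prod_nonneg fun v _ => hu v _
          _ ≤ ∑ x ∈ N, ∑ g ∈ irreducibleExtensions K (Function.update f x.1 x.2) m,
                ∏ v, u v (g v) :=
              sum_biUnion_le_sum_sum _ _ fun g => Finset.prod_nonneg fun v _ => hu v _
          _ ≤ ∑ x ∈ N, ((∏ v, u v (f v)) * u x.1 x.2) * (Q - η) ^ m := by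
              refine Finset.sum_le_sum fun x hx => ?_
              simp only [hN, Finset.mem_filter, Finset.mem_univ, true_and] at hx
              rw [← prod_update_of_eq_zero hu0 hx.1]
              refine ih _ fun h => hx.2 ?_
              have := congrFun h x.1
              simp at this
              rw [this, map_zero]
          _ = (∏ v, u v (f v)) * (Q - η) ^ m * ∑ x ∈ N, u x.1 x.2 := by
              rw [Finset.mul_sum]
              exact Finset.sum_congr rfl fun x _ => by ring
          _ ≤ (∏ v, u v (f v)) * (Q - η) ^ m * (Q - η) :=
              mul_le_mul_of_nonneg_left hNQ
                (mul_nonneg hnn (pow_nonneg (sub_nonneg.2 hQη) _))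
          _ = _ := by ring

open Classical in
/-- The total weight of the irreducible patterns with at least `d` positions which meet `S`. -/
theorem sum_irreducible_le {u : ∀ v, A v → ℝ} (hu : ∀ v a, 0 ≤ u v a)
    (hu0 : ∀ v, u v 0 = 1) {Q η : ℝ}
    (hη : ∀ v a, a ≠ 0 → u v a = 0 ∨ η ≤ u v a) (hη0 : 0 < η) (hQη : η < Q) (hQ1 : Q ≤ 1)
    (hK : ∀ g, g ∈ K ↔ ∀ j, ∑ v, χ j v (g v) = 0)
    (hQ : ∀ j, ∑ x : Σ v, A v with χ j x.1 x.2 ≠ 0, u x.1 x.2 ≤ Q) (S : Finset V) (d : ℕ)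
    (P : (∀ v, A v) → Prop)
    (hP : ∀ g, IsIrreduciblePattern K g → P g →
      (∃ v ∈ S, g v ≠ 0) ∧ d ≤ (patternSupport g).card) :
    ∑ g with IsIrreduciblePattern K g ∧ P g, ∏ v, u v (g v) ≤
      (∑ v ∈ S, ∑ a with a ≠ 0, u v a) * ((Q - η) ^ d / ((Q - η) * (1 - (Q - η)))) := by
  have hr0 : 0 < Q - η := sub_pos.2 hQη
  have hr1 : Q - η < 1 := by linarith
  set r := Q - η with hr
  set N := S.sigma fun v => Finset.univ.filter fun a : A v => a ≠ 0 with hN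
  -- Growth starts at one nonzero position in `S`, so a pattern with `c` positions takes `c - 1`
  -- further steps, where `d ≤ c ≤ card V`.
  set I := Finset.Ico (d - 1) (d + Fintype.card V) with hI
  have hnn : ∀ g : ∀ v, A v, 0 ≤ ∏ v, u v (g v) :=
    fun g => Finset.prod_nonneg fun v _ => hu v _
  have hcard1 : ∀ (v : V) (a : A v), a ≠ 0 →
      (patternSupport (Pi.single v a : ∀ v, A v)).card = 1 := by
    intro v a ha
    have := card_patternSupport_update (f := (0 : ∀ v, A v)) (v := v) rfl ha
    rwa [show patternSupport (0 : ∀ v, A v) = ∅ by ext; simp [mem_patternSupport],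
      Finset.card_empty, zero_add] at this
  have hsub : (Finset.univ.filter fun g => IsIrreduciblePattern K g ∧ P g) ⊆
      (N ×ˢ I).biUnion fun x => irreducibleExtensions K (Pi.single x.1.1 x.1.2) x.2 := by
    intro g hg
    simp only [Finset.mem_filter, Finset.mem_univ, true_and] at hg
    obtain ⟨⟨v, hvS, hv⟩, hd⟩ := hP g hg.1 hg.2
    have hpos : 0 < (patternSupport g).card :=
      Finset.card_pos.2 ⟨v, mem_patternSupport.2 hv⟩
    have hle : (patternSupport g).card ≤ Fintype.card V := Finset.card_le_univ _
    rw [Finset.mem_biUnion]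
    refine ⟨(⟨v, g v⟩, (patternSupport g).card - 1), ?_, ?_⟩
    · simp only [Finset.mem_product, hN, hI, Finset.mem_sigma, Finset.mem_filter,
        Finset.mem_univ, true_and, Finset.mem_Ico]
      exact ⟨⟨hvS, hv⟩, by omega, by omega⟩
    · rw [mem_irreducibleExtensions, hcard1 v _ hv]
      refine ⟨hg.1, fun w => ?_, by omega⟩
      by_cases h : w = v
      · subst h; simp
      · simp [h]
  have hgeom : ∑ m ∈ I, r ^ m ≤ r ^ d / (r * (1 - r)) := by
    have h1 : ∑ m ∈ I, r ^ m ≤ r ^ (d - 1) / (1 - r) := by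
      rw [hI]; exact geom_sum_Ico_le_of_lt_one hr0.le hr1
    -- The bound by `r ^ d / r` also covers `d = 0`, where `d - 1` is truncated to `0`, because `r ≤
    -- 1`.
    refine h1.trans ?_
    rw [div_mul_eq_div_div]
    refine div_le_div_of_nonneg_right ?_ (by linarith)
    rw [le_div_iff₀ hr0, ← pow_succ]
    exact pow_le_pow_of_le_one hr0.le hr1.le (by omega)
  calc _ ≤ ∑ g ∈ (N ×ˢ I).biUnion fun x => irreducibleExtensions K (Pi.single x.1.1 x.1.2) x.2,
        ∏ v, u v (g v) := Finset.sum_le_sum_of_subset_of_nonneg hsub fun g _ _ => hnn g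
    _ ≤ ∑ x ∈ N ×ˢ I, ∑ g ∈ irreducibleExtensions K (Pi.single x.1.1 x.1.2) x.2,
        ∏ v, u v (g v) := sum_biUnion_le_sum_sum _ _ fun g => hnn g
    _ ≤ ∑ x ∈ N ×ˢ I, u x.1.1 x.1.2 * r ^ x.2 := by
        refine Finset.sum_le_sum fun x hx => ?_
        simp only [Finset.mem_product, hN, Finset.mem_sigma, Finset.mem_filter,
          Finset.mem_univ, true_and] at hx
        have h1 := sum_irreducibleExtensions_le hu hu0 hη hQη.le hK hQ x.2
          (Pi.single x.1.1 x.1.2) (by simpa using hx.1.2)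
        refine h1.trans_eq ?_
        congr 1
        have := prod_update_of_eq_zero hu0 (f := (0 : ∀ v, A v)) (v := x.1.1) rfl x.1.2
        simpa [hu0, Pi.single] using this
    _ = (∑ v ∈ S, ∑ a with a ≠ 0, u v a) * ∑ m ∈ I, r ^ m := by
        rw [Finset.sum_product, Finset.sum_mul, hN, Finset.sum_sigma]
        refine Finset.sum_congr rfl fun v _ => ?_
        rw [Finset.sum_mul]
        exact Finset.sum_congr rfl fun a _ => (Finset.mul_sum I (fun m => r ^ m) (u v a)).symm
    _ ≤ _ := mul_le_mul_of_nonneg_left hgeom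
        (Finset.sum_nonneg fun v _ => Finset.sum_nonneg fun a _ => hu v a)

end Counting

/-! ### Bit flips and their Bhattacharyya parameter -/

theorem flipProb_nonneg {q : ℝ} (hq : q ∈ Set.Icc (0 : ℝ) 1) (b : ZMod 2) : 0 ≤ flipProb q b := by
  unfold flipProb
  split_ifs
  · linarith [hq.2]
  · exact hq.1

theorem sum_zmod_two (f : ZMod 2 → ℝ) : ∑ a, f a = f 0 + f 1 := Fin.sum_univ_two f

theorem sum_flipProb (q : ℝ) : ∑ b, flipProb q b = 1 := by
  simp [sum_zmod_two, flipProb]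

theorem zmod_two_eq_one {a : ZMod 2} (h : a ≠ 0) : a = 1 := by
  revert a; decide

theorem overlap_flipProb (q : ℝ) {g : ZMod 2} (hg : g ≠ 0) :
    overlap (flipProb q) g = 2 * √(q * (1 - q)) := by
  rw [zmod_two_eq_one hg, overlap, sum_zmod_two, zero_add, show (1 + 1 : ZMod 2) = 0 from rfl]
  simp only [flipProb, if_true, one_ne_zero, if_false]
  rw [mul_comm (1 - q)]
  ring

theorem prod_prod_sum {I K : Type*} [Fintype I] [Fintype K] [DecidableEq I] [DecidableEq K]
    {B : Type*} [Fintype B] (F : I → K → B → ℝ) :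
    ∏ i, ∏ k, ∑ b, F i k b = ∑ b : I → K → B, ∏ i, ∏ k, F i k (b i k) := by
  simp_rw [Finset.prod_univ_sum, Fintype.piFinset_univ]

/-! ### Spacetime errors and the checks given by syndrome changes -/

section Spacetime

/-- The places where an error can happen: a qubit in one of the `M` rounds, or a syndrome bit
measured in one of the rounds before the last one. -/
abbrev SpacetimeSite (n M : ℕ) (ι : Type) : Type := (Fin M × Fin n) ⊕ (Fin (M - 1) × ι)

/-- The errors possible at a site. -/
def SiteAlphabet {n M : ℕ} {ι : Type} (A : Type) : SpacetimeSite n M ι → Type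
  | .inl _ => A
  | .inr _ => ZMod 2

variable {n M : ℕ} {ι A : Type}

instance [AddCommGroup A] : ∀ v : SpacetimeSite n M ι, AddCommGroup (SiteAlphabet A v)
  | .inl _ => inferInstanceAs (AddCommGroup A)
  | .inr _ => inferInstanceAs (AddCommGroup (ZMod 2))

instance [Fintype A] : ∀ v : SpacetimeSite n M ι, Fintype (SiteAlphabet A v)
  | .inl _ => inferInstanceAs (Fintype A)
  | .inr _ => inferInstanceAs (Fintype (ZMod 2))

instance [DecidableEq A] : ∀ v : SpacetimeSite n M ι, DecidableEq (SiteAlphabet A v)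
  | .inl _ => inferInstanceAs (DecidableEq A)
  | .inr _ => inferInstanceAs (DecidableEq (ZMod 2))

/-- A pattern of spacetime errors consists of qubit errors and measurement errors. -/
def spacetimeEquiv (n M : ℕ) (ι A : Type) :
    (Fin M → Fin n → A) × (Fin (M - 1) → ι → ZMod 2) ≃
      ∀ v : SpacetimeSite n M ι, SiteAlphabet A v where
  toFun x
    | .inl (i, k) => x.1 i k
    | .inr (i, j) => x.2 i j
  invFun a := (fun i k => a (.inl (i, k)), fun i j => a (.inr (i, j)))
  left_inv _ := rfl
  right_inv a := by
    ext v
    rcases v with ⟨i, k⟩ | ⟨i, j⟩ <;> rfl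

/-- The qubit errors of a spacetime pattern. -/
def qubitErrors (a : ∀ v : SpacetimeSite n M ι, SiteAlphabet A v) (i : Fin M) (k : Fin n) : A :=
  a (.inl (i, k))

/-- The measurement errors of a spacetime pattern. -/
def measurementErrors (a : ∀ v : SpacetimeSite n M ι, SiteAlphabet A v) (i : Fin (M - 1)) (j : ι) :
    ZMod 2 :=
  a (.inr (i, j))

variable [AddCommGroup A]

theorem qubitErrors_zero :
    qubitErrors (0 : ∀ v : SpacetimeSite n M ι, SiteAlphabet A v) = 0 := rfl

theorem qubitErrors_add (a b : ∀ v : SpacetimeSite n M ι, SiteAlphabet A v) :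
    qubitErrors (a + b) = qubitErrors a + qubitErrors b := rfl

theorem measurementErrors_zero :
    measurementErrors (0 : ∀ v : SpacetimeSite n M ι, SiteAlphabet A v) = 0 := rfl

theorem measurementErrors_add (a b : ∀ v : SpacetimeSite n M ι, SiteAlphabet A v) :
    measurementErrors (a + b) = measurementErrors a + measurementErrors b := rfl

/-- The net qubit error of a spacetime pattern. -/
def netHom (n M : ℕ) (ι A : Type) [AddCommGroup A] :
    (∀ v : SpacetimeSite n M ι, SiteAlphabet A v) →+ (Fin n → A) where
  toFun a := fun k => ∑ i : Fin M, qubitErrors a i k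
  map_zero' := by
    ext k
    simp [qubitErrors_zero]
  map_add' a b := by
    ext k
    simp [qubitErrors_add, Finset.sum_add_distrib]

/-- The syndrome bits measured in the presence of a spacetime pattern. -/
def measuredHom (M : ℕ) (χ : ι → Fin n → A →+ ZMod 2) :
    (∀ v : SpacetimeSite n M ι, SiteAlphabet A v) →+ (Fin M → ι → ZMod 2) where
  toFun a := fun i j => ∑ k, χ j k (∑ i' ∈ Finset.Iic i, qubitErrors a i' k) +
    (if hi : (i : ℕ) < M - 1 then measurementErrors a ⟨i, hi⟩ j else 0)
  map_zero' := by
    ext i j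
    simp [qubitErrors_zero, measurementErrors_zero]
  map_add' a b := by
    ext i j
    simp only [qubitErrors_add, measurementErrors_add, Pi.add_apply, map_add,
      Finset.sum_add_distrib]
    split_ifs with hi
    · exact add_add_add_comm _ _ _ _
    · simp

/-- The change of the measured syndrome bit `j` in round `i` detects qubit errors of this round,
and measurement errors of this round and of the preceding one. -/
def spacetimeCheck [DecidableEq ι] (χ : ι → Fin n → A →+ ZMod 2) (x : Fin M × ι) :
    ∀ v : SpacetimeSite n M ι, SiteAlphabet A v →+ ZMod 2
  | .inl (i, k) => if i = x.1 then χ x.2 k else (0 : A →+ ZMod 2)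
  | .inr (i, j) => if j = x.2 ∧ ((i : ℕ) = x.1 ∨ (i : ℕ) + 1 = x.1) then
      AddMonoidHom.id (ZMod 2) else (0 : ZMod 2 →+ ZMod 2)

variable [Fintype ι] [DecidableEq ι]

omit [Fintype ι] in
theorem spacetimeCheck_inl (χ : ι → Fin n → A →+ ZMod 2) (i i' : Fin M) (j : ι) (k : Fin n)
    (a : A) : spacetimeCheck χ (i, j) (.inl (i', k)) a = if i' = i then χ j k a else 0 := by
  by_cases h : i' = i <;> simp only [spacetimeCheck, h, if_true, if_false] <;> rfl

omit [Fintype ι] in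
theorem spacetimeCheck_inr (χ : ι → Fin n → A →+ ZMod 2) (i : Fin M) (i' : Fin (M - 1))
    (j j' : ι) (a : ZMod 2) : spacetimeCheck χ (i, j) (.inr (i', j')) a =
      if j' = j ∧ ((i' : ℕ) = i ∨ (i' : ℕ) + 1 = i) then a else 0 := by
  change (if j' = j ∧ ((i' : ℕ) = i ∨ (i' : ℕ) + 1 = i) then AddMonoidHom.id (ZMod 2)
    else (0 : ZMod 2 →+ ZMod 2)) a = _
  split_ifs <;> rfl

theorem sum_spacetimeCheck (χ : ι → Fin n → A →+ ZMod 2) (i : Fin M) (j : ι)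
    (a : ∀ v : SpacetimeSite n M ι, SiteAlphabet A v) :
    ∑ v, spacetimeCheck χ (i, j) v (a v) = ∑ k, χ j k (qubitErrors a i k) +
      ∑ i' : Fin (M - 1), if (i' : ℕ) = i ∨ (i' : ℕ) + 1 = i then
        measurementErrors a i' j else 0 := by
  rw [Fintype.sum_sum_type, Fintype.sum_prod_type, Fintype.sum_prod_type]
  congr 1
  · calc _ = ∑ i' : Fin M, ∑ k, if i' = i then χ j k (qubitErrors a i' k) else 0 :=
          Finset.sum_congr rfl fun i' _ => Finset.sum_congr rfl fun k _ =>
            spacetimeCheck_inl χ i i' j k _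
      _ = _ := by
          rw [Finset.sum_comm]
          simp
  · calc _ = ∑ i' : Fin (M - 1), ∑ j', if j' = j ∧ ((i' : ℕ) = i ∨ (i' : ℕ) + 1 = i) then
            measurementErrors a i' j' else 0 :=
          Finset.sum_congr rfl fun i' _ => Finset.sum_congr rfl fun j' _ =>
            spacetimeCheck_inr χ i i' j j' _
      _ = _ := by
          simp [ite_and]

/-- With `m = M - 1`, the first term is missing in the last round, which is noiseless, and the
second in round `0`. The guard `0 < i` is needed because `0 - 1 = 0`. -/
theorem sum_fin_ite_eq_or_succ_eq {m : ℕ} (f : Fin m → ZMod 2) (i : ℕ) :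
    (∑ i' : Fin m, if (i' : ℕ) = i ∨ (i' : ℕ) + 1 = i then f i' else 0) =
      (if hi : i < m then f ⟨i, hi⟩ else 0) +
        (if hi : 0 < i ∧ i - 1 < m then f ⟨i - 1, hi.2⟩ else 0) := by
  have h1 : ∀ i' : Fin m, (if (i' : ℕ) = i ∨ (i' : ℕ) + 1 = i then f i' else 0) =
      (if (i' : ℕ) = i then f i' else 0) + (if (i' : ℕ) + 1 = i then f i' else 0) := by
    intro i'
    by_cases h : (i' : ℕ) = i
    · have : ¬ ((i' : ℕ) + 1 = i) := by omega
      simp [h]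
    · simp [h]
  simp_rw [h1, Finset.sum_add_distrib]
  congr 1
  · split_ifs with hi
    · rw [Finset.sum_eq_single ⟨i, hi⟩]
      · simp
      · intro b _ hb
        rw [if_neg fun h => hb (Fin.ext h)]
      · simp
    · refine Finset.sum_eq_zero fun b _ => if_neg ?_
      have := b.2
      omega
  · split_ifs with hi
    · rw [Finset.sum_eq_single ⟨i - 1, hi.2⟩]
      · rw [if_pos (by simp only; omega)]
      · intro b _ hb
        rw [if_neg fun h => hb (Fin.ext (by simp only; omega))]
      · simp
    · refine Finset.sum_eq_zero fun b _ => if_neg ?_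
      have := b.2
      omega

/-- The sum telescopes: measurement errors of earlier rounds enter two consecutive checks and cancel
modulo 2, while that of round `i` enters only one check of the sum. -/
theorem measuredHom_eq_sum (χ : ι → Fin n → A →+ ZMod 2)
    (a : ∀ v : SpacetimeSite n M ι, SiteAlphabet A v) (j : ι) (i : ℕ) (hi : i < M) :
    measuredHom M χ a ⟨i, hi⟩ j =
      ∑ i' ∈ Finset.Iic (⟨i, hi⟩ : Fin M), ∑ v, spacetimeCheck χ (i', j) v (a v) := by
  induction i with
  | zero =>
    have : Finset.Iic (⟨0, hi⟩ : Fin M) = {⟨0, hi⟩} := by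
      ext x
      simp [Fin.le_def, Fin.ext_iff]
    rw [this, Finset.sum_singleton, sum_spacetimeCheck, sum_fin_ite_eq_or_succ_eq]
    simp [measuredHom, this]
  | succ i ih =>
    have hins : Finset.Iic (⟨i + 1, hi⟩ : Fin M) =
        insert ⟨i + 1, hi⟩ (Finset.Iic (⟨i, by omega⟩ : Fin M)) := by
      ext x
      simp only [Finset.mem_Iic, Finset.mem_insert, Fin.le_def, Fin.ext_iff]
      omega
    have hnot : (⟨i + 1, hi⟩ : Fin M) ∉ Finset.Iic (⟨i, by omega⟩ : Fin M) := by
      simp [Fin.le_def]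
    rw [hins, Finset.sum_insert hnot, ← ih (by omega), sum_spacetimeCheck,
      sum_fin_ite_eq_or_succ_eq]
    have h1 : 0 < i + 1 ∧ i + 1 - 1 < M - 1 := by omega
    have h2 : i < M - 1 := by omega
    simp only [measuredHom, AddMonoidHom.coe_mk, ZeroHom.coe_mk, hins, Finset.sum_insert hnot,
      map_add, Finset.sum_add_distrib, h1, h2, and_self, dif_pos, Nat.add_sub_cancel]
    have h3 : ∀ x : ZMod 2, x + x = 0 := by decide
    generalize measurementErrors a ⟨i, h2⟩ j = x
    linear_combination -(h3 x)

/-- Measured bits are partial sums of checks, so all of them vanish if and only if all checks do.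
This replaces syndromes of accumulated errors by local checks of bounded total weight. -/
theorem mem_ker_measuredHom (χ : ι → Fin n → A →+ ZMod 2)
    (a : ∀ v : SpacetimeSite n M ι, SiteAlphabet A v) :
    a ∈ (measuredHom M χ).ker ↔ ∀ x, ∑ v, spacetimeCheck χ x v (a v) = 0 := by
  rw [AddMonoidHom.mem_ker]
  constructor
  · rintro h ⟨⟨i, hi⟩, j⟩
    have hz : ∀ i hi, ∑ i' ∈ Finset.Iic (⟨i, hi⟩ : Fin M),
        ∑ v, spacetimeCheck χ (i', j) v (a v) = 0 := fun i hi => by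
      rw [← measuredHom_eq_sum, h]; rfl
    cases i with
    | zero =>
      have h0 := hz 0 hi
      have : Finset.Iic (⟨0, hi⟩ : Fin M) = {⟨0, hi⟩} := by
        ext x
        simp [Fin.le_def, Fin.ext_iff]
      rwa [this, Finset.sum_singleton] at h0
    | succ i =>
      have h1 := hz (i + 1) hi
      have h0 := hz i (by omega)
      have hins : Finset.Iic (⟨i + 1, hi⟩ : Fin M) =
          insert ⟨i + 1, hi⟩ (Finset.Iic (⟨i, by omega⟩ : Fin M)) := by
        ext x
        simp only [Finset.mem_Iic, Finset.mem_insert, Fin.le_def, Fin.ext_iff]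
        omega
      rwa [hins, Finset.sum_insert (by simp [Fin.le_def]), h0, add_zero] at h1
  · intro h
    ext ⟨i, hi⟩ j
    rw [measuredHom_eq_sum]
    exact Finset.sum_eq_zero fun i' _ => h (i', j)

omit [Fintype ι] [DecidableEq ι] in
-- The last round is noiseless and measures exactly the net error.
theorem check_netHom_eq_zero (χ : ι → Fin n → A →+ ZMod 2) (hM : 1 ≤ M)
    {a : ∀ v : SpacetimeSite n M ι, SiteAlphabet A v} (ha : a ∈ (measuredHom M χ).ker) (j : ι) :
    ∑ k, χ j k (netHom n M ι A a k) = 0 := by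
  have h := congrFun (congrFun (AddMonoidHom.mem_ker.1 ha) ⟨M - 1, by omega⟩) j
  have huniv : Finset.Iic (⟨M - 1, by omega⟩ : Fin M) = Finset.univ := by
    ext x
    have := x.2
    simp only [Finset.mem_Iic, Fin.le_def, Finset.mem_univ, iff_true]
    omega
  simpa [measuredHom, huniv, netHom] using h

variable [DecidableEq A] [Fintype A]

omit [DecidableEq ι] [Fintype A] in
-- A qubit with nonzero net error has a nonzero error in some round. In the proof, `none` absorbs
-- the measurement sites.
theorem hammingNorm_netHom_le (a : ∀ v : SpacetimeSite n M ι, SiteAlphabet A v) :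
    hammingNorm (netHom n M ι A a) ≤ (patternSupport a).card := by
  have hsub : (Finset.univ.filter fun k => netHom n M ι A a k ≠ 0).map Function.Embedding.some ⊆
      (patternSupport a).image (Sum.elim (fun x => some x.2) fun _ => none) := by
    intro o ho
    rw [Finset.mem_map] at ho
    obtain ⟨k, hk, rfl⟩ := ho
    have hk' : ∑ i, qubitErrors a i k ≠ 0 := (Finset.mem_filter.1 hk).2
    obtain ⟨i, -, hi⟩ := Finset.exists_ne_zero_of_sum_ne_zero hk'
    exact Finset.mem_image.2 ⟨.inl (i, k), mem_patternSupport.2 hi, rfl⟩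
  calc hammingNorm (netHom n M ι A a)
      = ((Finset.univ.filter fun k => netHom n M ι A a k ≠ 0).map
          Function.Embedding.some).card := by rw [Finset.card_map]; rfl
    _ ≤ _ := (Finset.card_le_card hsub).trans Finset.card_image_le

/-- The weights of the errors at a site for given erasure flags `b`. -/
noncomputable def siteProb (ρ : Bool × A → ℝ) (q : ℝ) (b : Fin M → Fin n → Bool) :
    ∀ v : SpacetimeSite n M ι, SiteAlphabet A v → ℝ
  | .inl (i, k) => fun a => ρ (b i k, a)
  | .inr _ => flipProb q

/-- The Bhattacharyya parameters of the errors at a site. -/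
noncomputable def siteOverlap (ρ : Bool × A → ℝ) (q : ℝ) :
    ∀ v : SpacetimeSite n M ι, SiteAlphabet A v → ℝ
  | .inl _ => fun a => ∑ b, overlap (fun a => ρ (b, a)) a
  | .inr _ => fun a => overlap (flipProb q) a

omit [DecidableEq ι] [DecidableEq A] in
-- Each erasure flag affects a single qubit site, so the sum over all flags distributes over the
-- product. The flags stay outside the square roots because the decoder knows them.
theorem sum_prod_overlap_siteProb (ρ : Bool × A → ℝ) (q : ℝ)
    (g : ∀ v : SpacetimeSite n M ι, SiteAlphabet A v) :
    ∑ b : Fin M → Fin n → Bool, ∏ v, overlap (siteProb ρ q b v) (g v) =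
      ∏ v, siteOverlap ρ q v (g v) := by
  simp only [Fintype.prod_sum_type, Fintype.prod_prod_type]
  rw [show (∏ i : Fin M, ∏ k : Fin n, siteOverlap ρ q (.inl (i, k) : SpacetimeSite n M ι)
      (g (.inl (i, k)))) = ∏ i : Fin M, ∏ k : Fin n, ∑ b : Bool,
        overlap (fun a => ρ (b, a)) (g (.inl (i, k)) : A) from rfl,
    prod_prod_sum, Finset.sum_mul]
  rfl

omit [DecidableEq A] in
-- A check sees at most two measurement errors, each with parameter `2 * √(q * (1 - q))`, and the
-- qubits of a single round.
theorem sum_siteOverlap_check_le (χ : ι → Fin n → A →+ ZMod 2) (ρ : Bool × A → ℝ) {q z : ℝ}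
    (hz : ∀ g, g ≠ 0 → ∑ b, overlap (fun a => ρ (b, a)) g = z) (x : Fin M × ι) :
    ∑ y : Σ v : SpacetimeSite n M ι, SiteAlphabet A v with spacetimeCheck χ x y.1 y.2 ≠ 0,
        siteOverlap ρ q y.1 y.2 ≤
      4 * √(q * (1 - q)) +
        (Finset.univ.filter fun y : Fin n × A => χ x.2 y.1 y.2 ≠ 0).card * z := by
  obtain ⟨i, j⟩ := x
  rw [Finset.sum_filter, Fintype.sum_sigma, Fintype.sum_sum_type, Fintype.sum_prod_type,
    Fintype.sum_prod_type, add_comm]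
  refine add_le_add ?_ (le_of_eq ?_)
  · calc _ = ∑ i' : Fin (M - 1), ∑ j', ∑ a : ZMod 2,
            if (if j' = j ∧ ((i' : ℕ) = i ∨ (i' : ℕ) + 1 = i) then a else 0) ≠ 0 then
              overlap (flipProb q) a else 0 :=
          Finset.sum_congr rfl fun i' _ => Finset.sum_congr rfl fun j' _ =>
            Finset.sum_congr rfl fun (a : ZMod 2) _ =>
              if_congr (by rw [← spacetimeCheck_inr χ i i' j j' a]) rfl rfl
      _ = ∑ i' : Fin (M - 1), ∑ j', if j' = j then
            if (i' : ℕ) = i ∨ (i' : ℕ) + 1 = i then 2 * √(q * (1 - q)) else 0 else 0 := by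
          refine Finset.sum_congr rfl fun i' _ => Finset.sum_congr rfl fun j' _ => ?_
          rw [← ite_and, sum_zmod_two, overlap_flipProb q one_ne_zero]
          by_cases h : j' = j ∧ ((i' : ℕ) = i ∨ (i' : ℕ) + 1 = i)
          · simp only [if_pos h]; simp
          · simp only [if_neg h]; simp
      _ ≤ _ := by
          simp only [Finset.sum_ite_eq', Finset.mem_univ, if_true]
          rw [← Finset.sum_filter, Finset.sum_const, nsmul_eq_mul]
          have hcard : (Finset.univ.filter fun i' : Fin (M - 1) =>
              (i' : ℕ) = i ∨ (i' : ℕ) + 1 = i).card ≤ 2 := by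
            refine (Finset.card_le_card_of_injOn (fun i' : Fin (M - 1) => (i' : ℕ))
              (t := {(i : ℕ), (i : ℕ) - 1}) ?_ ?_).trans Finset.card_le_two
            · intro i' hi'
              simp at hi' ⊢
              omega
            · exact fun _ _ _ _ h => Fin.ext h
          have hcard' : ((Finset.univ.filter fun i' : Fin (M - 1) =>
              (i' : ℕ) = i ∨ (i' : ℕ) + 1 = i).card : ℝ) ≤ 2 := by exact_mod_cast hcard
          nlinarith [Real.sqrt_nonneg (q * (1 - q))]
  · calc _ = ∑ i' : Fin M, ∑ k, ∑ a : A, if (if i' = i then χ j k a else 0) ≠ 0 then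
            ∑ b, overlap (fun a => ρ (b, a)) a else 0 :=
          Finset.sum_congr rfl fun i' _ => Finset.sum_congr rfl fun k _ =>
            Finset.sum_congr rfl fun (a : A) _ =>
              if_congr (by rw [← spacetimeCheck_inl χ i i' j k a]) rfl rfl
      _ = ∑ k, ∑ a : A, if χ j k a ≠ 0 then z else 0 := by
          rw [Finset.sum_eq_single i]
          · refine Finset.sum_congr rfl fun k _ => Finset.sum_congr rfl fun a _ => ?_
            rw [if_pos rfl]
            by_cases h : χ j k a = 0
            · rw [if_neg (not_not.2 h), if_neg (not_not.2 h)]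
            · rw [if_pos h, if_pos h, hz a fun h0 => h (by rw [h0, map_zero])]
          · intro i' _ hi'
            simp [hi']
          · simp
      _ = _ := by
          rw [Finset.card_filter, Fintype.sum_prod_type, Nat.cast_sum, Finset.sum_mul]
          refine Finset.sum_congr rfl fun k _ => ?_
          rw [Nat.cast_sum, Finset.sum_mul]
          refine Finset.sum_congr rfl fun a _ => ?_
          by_cases h : χ j k a = 0 <;> simp [h]

end Spacetime

/-! ### Decoding of repeated noisy measurements -/

section SpacetimeDecoder

variable {n M : ℕ} {ι A : Type} [AddCommGroup A] [Fintype ι] [DecidableEq ι] [DecidableEq A]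
  [Fintype A]

omit [AddCommGroup A] [Fintype ι] [DecidableEq ι] [DecidableEq A] [Fintype A] in
theorem siteProb_nonneg {ρ : Bool × A → ℝ} (hρ : ∀ x, 0 ≤ ρ x) {q : ℝ}
    (hq : q ∈ Set.Icc (0 : ℝ) 1) (b : Fin M → Fin n → Bool) :
    ∀ (v : SpacetimeSite n M ι) (a : SiteAlphabet A v), 0 ≤ siteProb ρ q b v a
  | .inl _, _ => hρ _
  | .inr _, a => flipProb_nonneg hq a

omit [Fintype ι] [DecidableEq ι] [DecidableEq A] in
theorem siteOverlap_nonneg (ρ : Bool × A → ℝ) (q : ℝ) :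
    ∀ (v : SpacetimeSite n M ι) (a : SiteAlphabet A v), 0 ≤ siteOverlap ρ q v a
  | .inl _, _ => Finset.sum_nonneg fun _ _ => overlap_nonneg _ _
  | .inr _, _ => overlap_nonneg _ _

omit [Fintype ι] [DecidableEq ι] [DecidableEq A] in
theorem siteOverlap_zero {ρ : Bool × A → ℝ} (hρ : ∀ x, 0 ≤ ρ x) (hρ1 : ∑ x, ρ x = 1) {q : ℝ}
    (hq : q ∈ Set.Icc (0 : ℝ) 1) :
    ∀ v : SpacetimeSite n M ι, siteOverlap ρ q v 0 = 1
  | .inl _ => by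
    rw [Fintype.sum_prod_type] at hρ1
    rw [← hρ1]
    exact Finset.sum_congr rfl fun b _ => overlap_zero fun a => hρ _
  | .inr _ => (overlap_zero (flipProb_nonneg hq)).trans (sum_flipProb q)

omit [Fintype ι] [DecidableEq ι] [DecidableEq A] in
theorem siteOverlap_eq_zero_or_le {ρ : Bool × A → ℝ} {q z η : ℝ}
    (hz : ∀ g, g ≠ 0 → ∑ b, overlap (fun a => ρ (b, a)) g = z) (hη : z = 0 ∨ η ≤ z)
    (hη' : 2 * √(q * (1 - q)) = 0 ∨ η ≤ 2 * √(q * (1 - q))) :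
    ∀ (v : SpacetimeSite n M ι) (a : SiteAlphabet A v), a ≠ 0 →
      siteOverlap ρ q v a = 0 ∨ η ≤ siteOverlap ρ q v a
  | .inl _, a, ha => by
    have : siteOverlap ρ q (.inl _ : SpacetimeSite n M ι) a = z := hz a ha
    rwa [this]
  | .inr _, a, ha => by
    have : siteOverlap ρ q (.inr _ : SpacetimeSite n M ι) a = 2 * √(q * (1 - q)) :=
      overlap_flipProb q ha
    rwa [this]

omit [Fintype ι] [DecidableEq ι] [DecidableEq A] [Fintype A] in
-- The growth of a nontrivial pattern can thus start at one of `M * n` qubit sites, and the number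
-- of generators does not enter the bound.
theorem exists_qubit_of_netHom_ne_zero {a : ∀ v : SpacetimeSite n M ι, SiteAlphabet A v}
    (h : netHom n M ι A a ≠ 0) : ∃ x : Fin M × Fin n, a (.inl x) ≠ 0 := by
  obtain ⟨k, hk⟩ := Function.ne_iff.1 h
  obtain ⟨i, -, hi⟩ := Finset.exists_ne_zero_of_sum_ne_zero
    (show ∑ i, qubitErrors a i k ≠ 0 from hk)
  exact ⟨(i, k), hi⟩

open Classical in
/-- The total weight of the irreducible undetectable spacetime patterns with nontrivial net
error. -/
theorem sum_irreducible_spacetime_le (χ : ι → Fin n → A →+ ZMod 2)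
    (T : AddSubgroup (Fin n → A)) {ρ : Bool × A → ℝ} (hρ : ∀ x, 0 ≤ ρ x) (hρ1 : ∑ x, ρ x = 1)
    {q z Q η : ℝ} (hq : q ∈ Set.Icc (0 : ℝ) 1)
    (hz : ∀ g, g ≠ 0 → ∑ b, overlap (fun a => ρ (b, a)) g = z) (hz0 : 0 ≤ z)
    (hη : z = 0 ∨ η ≤ z)
    (hη' : 2 * √(q * (1 - q)) = 0 ∨ η ≤ 2 * √(q * (1 - q))) (hη0 : 0 < η) (hηQ : η < Q)
    (hQ1 : Q ≤ 1)
    (hQ : ∀ j, 4 * √(q * (1 - q)) +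
      (Finset.univ.filter fun y : Fin n × A => χ j y.1 y.2 ≠ 0).card * z ≤ Q)
    (hM : 1 ≤ M) (d : ℕ)
    (hd : ∀ e ∉ T, (∀ j, ∑ k, χ j k (e k) = 0) → d ≤ hammingNorm e) :
    ∑ g with IsIrreduciblePattern (measuredHom M χ).ker g ∧ g ∉ T.comap (netHom n M ι A),
        ∏ v, siteOverlap ρ q v (g v) ≤
      (M * n * (Fintype.card A * z)) * ((Q - η) ^ d / ((Q - η) * (1 - (Q - η)))) := by
  have h := sum_irreducible_le (K := (measuredHom M χ).ker) (χ := spacetimeCheck χ)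
    (siteOverlap_nonneg ρ q) (siteOverlap_zero hρ hρ1 hq)
    (siteOverlap_eq_zero_or_le hz hη hη') hη0 hηQ hQ1 (mem_ker_measuredHom χ)
    (fun x => (sum_siteOverlap_check_le χ ρ hz x).trans (hQ x.2))
    (Finset.univ.map Function.Embedding.inl) d (fun g => g ∉ T.comap (netHom n M ι A))
    (fun g hg hgT => by
      rw [AddSubgroup.mem_comap] at hgT
      obtain ⟨x, hx⟩ := exists_qubit_of_netHom_ne_zero fun h => hgT (h ▸ T.zero_mem)
      exact ⟨⟨.inl x, by simp, hx⟩,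
        (hd _ hgT (check_netHom_eq_zero χ hM hg.1)).trans (hammingNorm_netHom_le g)⟩)
  refine (Finset.sum_congr (by ext; simp) fun _ _ => rfl).trans_le
    (h.trans (mul_le_mul_of_nonneg_right ?_ ?_))
  · rw [Finset.sum_map]
    calc _ ≤ ∑ x : Fin M × Fin n, ∑ a : A, z := by
          refine Finset.sum_le_sum fun x _ => ?_
          calc _ = ∑ a : A with a ≠ 0, z :=
                Finset.sum_congr rfl fun a ha => hz a (Finset.mem_filter.1 ha).2
            _ ≤ _ := Finset.sum_le_sum_of_subset_of_nonneg (Finset.filter_subset _ _)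
                fun _ _ _ => hz0
      _ = _ := by simp
  · have : Q - η < 1 := by linarith
    have : 0 < Q - η := by linarith
    positivity

omit [AddCommGroup A] [DecidableEq A] in
/-- Samples are pairs of erasure flags and errors. -/
theorem sum_history_eq (F : (Fin M → Fin n → Bool) → (Fin M → Fin n → A) → ℝ) :
    ∑ h : Fin M → Fin n → Bool × A, F (fun i k => (h i k).1) (fun i k => (h i k).2) =
      ∑ b, ∑ e, F b e := by
  rw [← Fintype.sum_prod_type']
  exact Fintype.sum_equiv
    { toFun := fun h => (fun i k => (h i k).1, fun i k => (h i k).2)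
      invFun := fun x i k => (x.1 i k, x.2 i k)
      left_inv := fun _ => rfl
      right_inv := fun _ => rfl } _ _ fun _ => rfl

open Classical in
/-- Decoding of repeated noisy measurements of the checks `χ`, where errors in `T` are
harmless. -/
theorem exists_spacetime_decoder (χ : ι → Fin n → A →+ ZMod 2)
    (T : AddSubgroup (Fin n → A)) {ρ : Bool × A → ℝ} (hρ : ∀ x, 0 ≤ ρ x) (hρ1 : ∑ x, ρ x = 1)
    {q z Q η : ℝ} (hq : q ∈ Set.Icc (0 : ℝ) 1)
    (hz : ∀ g, g ≠ 0 → ∑ b, overlap (fun a => ρ (b, a)) g = z) (hz0 : 0 ≤ z)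
    (hη : z = 0 ∨ η ≤ z)
    (hη' : 2 * √(q * (1 - q)) = 0 ∨ η ≤ 2 * √(q * (1 - q))) (hη0 : 0 < η) (hηQ : η < Q)
    (hQ1 : Q ≤ 1)
    (hQ : ∀ j, 4 * √(q * (1 - q)) +
      (Finset.univ.filter fun y : Fin n × A => χ j y.1 y.2 ≠ 0).card * z ≤ Q)
    (hM : 1 ≤ M) :
    ∃ dec : (Fin M → Fin n → Bool) → (Fin M → ι → ZMod 2) → Fin n → A,
      ∀ d : ℕ, (∀ e ∉ T, (∀ j, ∑ k, χ j k (e k) = 0) → d ≤ hammingNorm e) →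
        ∑ h : Fin M → Fin n → Bool × A, ∑ ε : Fin (M - 1) → ι → ZMod 2,
          (∏ i, ∏ k, ρ (h i k)) * (∏ i, ∏ j, flipProb q (ε i j)) *
            (if dec (fun i k => (h i k).1) (fun i j =>
                ∑ k, χ j k (∑ i' ∈ Finset.Iic i, (h i' k).2) +
                  (if hi : (i : ℕ) < M - 1 then ε ⟨i, hi⟩ j else 0)) +
                (fun k => ∑ i, (h i k).2) ∈ T then 0 else 1) ≤
        (M * n * (Fintype.card A * z)) * ((Q - η) ^ d / ((Q - η) * (1 - (Q - η)))) := by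
  choose δ hδ using fun b : Fin M → Fin n → Bool =>
    exists_decoder_failure_le (measuredHom M χ) (T.comap (netHom n M ι A))
      (siteProb_nonneg hρ hq b)
  -- The correction is the inverse of the estimated net error, so correction plus net error is, up
  -- to sign, the net error of `δ b s - a`. The decoder is fixed before `d`.
  refine ⟨fun b s => -netHom n M ι A (δ b s), fun d hd => ?_⟩
  calc _ = ∑ b : Fin M → Fin n → Bool, ∑ e : Fin M → Fin n → A,
          ∑ ε : Fin (M - 1) → ι → ZMod 2,
          (∏ i, ∏ k, ρ (b i k, e i k)) * (∏ i, ∏ j, flipProb q (ε i j)) *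
            (if -netHom n M ι A (δ b (fun i j =>
                ∑ k, χ j k (∑ i' ∈ Finset.Iic i, e i' k) +
                  (if hi : (i : ℕ) < M - 1 then ε ⟨i, hi⟩ j else 0))) +
                (fun k => ∑ i, e i k) ∈ T then 0 else 1) :=
        sum_history_eq fun b e => ∑ ε : Fin (M - 1) → ι → ZMod 2,
          (∏ i, ∏ k, ρ (b i k, e i k)) * (∏ i, ∏ j, flipProb q (ε i j)) *
            (if -netHom n M ι A (δ b (fun i j =>
                ∑ k, χ j k (∑ i' ∈ Finset.Iic i, e i' k) +
                  (if hi : (i : ℕ) < M - 1 then ε ⟨i, hi⟩ j else 0))) +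
                (fun k => ∑ i, e i k) ∈ T then 0 else 1)
    _ = ∑ b : Fin M → Fin n → Bool, ∑ a : ∀ v : SpacetimeSite n M ι, SiteAlphabet A v,
          (∏ v, siteProb ρ q b v (a v)) * (if δ b (measuredHom M χ a) - a ∈
            T.comap (netHom n M ι A) then 0 else 1) := by
        refine Finset.sum_congr rfl fun b _ => ?_
        rw [← Fintype.sum_prod_type']
        refine Fintype.sum_equiv (spacetimeEquiv n M ι A) _ _ fun x => ?_
        congr 1
        · rw [Fintype.prod_sum_type, Fintype.prod_prod_type, Fintype.prod_prod_type]
          rfl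
        · refine if_congr ?_ rfl rfl
          rw [AddSubgroup.mem_comap, map_sub, ← neg_mem_iff (H := T), neg_add, neg_neg,
            ← sub_eq_add_neg]
          rfl
    _ ≤ ∑ b : Fin M → Fin n → Bool, ∑ g with IsIrreduciblePattern (measuredHom M χ).ker g ∧
          g ∉ T.comap (netHom n M ι A), ∏ v, overlap (siteProb ρ q b v) (g v) :=
        Finset.sum_le_sum fun b _ => hδ b
    _ = ∑ g with IsIrreduciblePattern (measuredHom M χ).ker g ∧
          g ∉ T.comap (netHom n M ι A), ∏ v, siteOverlap ρ q v (g v) := by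
        rw [Finset.sum_comm]
        exact Finset.sum_congr rfl fun g _ => sum_prod_overlap_siteProb ρ q g
    _ ≤ _ := sum_irreducible_spacetime_le χ T hρ hρ1 hq hz hz0 hη hη' hη0 hηQ hQ1 hQ hM d hd

end SpacetimeDecoder

/-! ### From exponential decay in the distance to vanishing error rates -/

theorem qubitProb_nonneg {y : ℝ} (hy : y ∈ Set.Icc (0 : ℝ) 1) {π : ZMod 2 × ZMod 2 → ℝ}
    (hπ : ∀ e, 0 ≤ π e) (a : Bool × (ZMod 2 × ZMod 2)) : 0 ≤ qubitProb y π a := by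
  unfold qubitProb
  split_ifs
  · linarith [hy.1]
  · exact mul_nonneg (sub_nonneg.2 hy.2) (hπ _)

theorem failureProb_nonneg {n : ℕ} {ι : Type} [Fintype ι] [DecidableEq ι]
    (C : StabilizerCode n ι) {y q : ℝ} (hy : y ∈ Set.Icc (0 : ℝ) 1) (hq : q ∈ Set.Icc (0 : ℝ) 1)
    {π : ZMod 2 × ZMod 2 → ℝ} (hπ : ∀ e, 0 ≤ π e) (M : ℕ) (dec : Decoder n ι M) :
    0 ≤ failureProb C y π q M dec := by
  unfold failureProb
  refine Finset.sum_nonneg fun h _ => Finset.sum_nonneg fun ε _ => mul_nonneg (mul_nonneg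
    (Finset.prod_nonneg fun i _ => Finset.prod_nonneg fun k _ => qubitProb_nonneg hy hπ _)
    (Finset.prod_nonneg fun i _ => Finset.prod_nonneg fun j _ => flipProb_nonneg hq _)) ?_
  split_ifs <;> norm_num

theorem natCast_mul_exp_pow_le_one {D : ℝ} (hD : 0 < D) {n d : ℕ}
    (h : D * Real.log n ≤ d) : (n : ℝ) * Real.exp (-1 / D) ^ d ≤ 1 := by
  rcases Nat.eq_zero_or_pos n with rfl | hn
  · simp
  · rw [← Real.exp_nat_mul]
    nth_rewrite 1 [← Real.exp_log (Nat.cast_pos.2 hn : (0 : ℝ) < n)]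
    rw [← Real.exp_add, Real.exp_le_one_iff]
    have : Real.log n ≤ d / D := by rwa [le_div_iff₀ hD, mul_comm]
    calc Real.log n + d * (-1 / D) ≤ d / D + d * (-1 / D) := by linarith
      _ = 0 := by ring

/-- Exponential decay of the failure probability in the distance, with a rate below
`exp (-1 / D)`, implies vanishing error rates. -/
theorem vanishingErrorRates_of_failureProb_le {n : ℕ → ℕ} {ι : ℕ → Type} [∀ t, Fintype (ι t)]
    [∀ t, DecidableEq (ι t)] (C : ∀ t, StabilizerCode (n t) (ι t)) {y q D K r : ℝ}
    {π : ZMod 2 × ZMod 2 → ℝ} (hy : y ∈ Set.Icc (0 : ℝ) 1) (hq : q ∈ Set.Icc (0 : ℝ) 1)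
    (hπ : ∀ e, 0 ≤ π e) (hD : 0 < D) (hn : Tendsto n atTop atTop)
    (hdist : ∀ t, ENNReal.ofReal (D * Real.log (n t)) ≤ ((C t).distance : ℝ≥0∞))
    (hK : 0 ≤ K) (hr0 : 0 < r) (hr : r < Real.exp (-1 / D))
    (h : ∀ t M, 1 ≤ M → ∃ dec : Decoder (n t) (ι t) M, ∀ d : ℕ, (d : ℕ∞) ≤ (C t).distance →
      failureProb (C t) y π q M dec ≤ M * n t * (K * r ^ d)) :
    VanishingErrorRates C y π q := by
  have h' : ∀ t M, ∃ dec : Decoder (n t) (ι t) M, 1 ≤ M → ∀ d : ℕ, (d : ℕ∞) ≤ (C t).distance →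
      failureProb (C t) y π q M dec ≤ M * n t * (K * r ^ d) := by
    intro t M
    by_cases hM : 1 ≤ M
    · obtain ⟨dec, hdec⟩ := h t M hM
      exact ⟨dec, fun _ => hdec⟩
    · exact ⟨fun _ _ => 0, fun h => (hM h).elim⟩
  choose dec hdec using h'
  -- For infinite distance every `d` is admissible, and the ceiling of `D * log n` serves as a
  -- finite substitute.
  have hd : ∀ t, ∃ d : ℕ, (d : ℕ∞) ≤ (C t).distance ∧ D * Real.log (n t) ≤ d ∧
      ((C t).distance = ⊤ ∨ (C t).distance = d) := by
    intro t
    rcases eq_or_ne (C t).distance ⊤ with htop | htop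
    · exact ⟨⌈D * Real.log (n t)⌉₊, by simp [htop], Nat.le_ceil _, Or.inl htop⟩
    · obtain ⟨d, hd⟩ := ENat.ne_top_iff_exists.1 htop
      refine ⟨d, hd.le, ?_, Or.inr hd.symm⟩
      have := hdist t
      rw [← hd, ENat.toENNReal_coe] at this
      exact (ENNReal.ofReal_le_natCast).1 this
  choose d hdle hdlog hdtop using hd
  set Q := Real.exp (-1 / D) with hQ
  have hQ0 : 0 < Q := Real.exp_pos _
  -- Writing `r = Q * s`, the factor `Q ^ d` absorbs the number of qubits and `s ^ d` still decays.
  set s := r / Q with hs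
  have hs0 : 0 < s := div_pos hr0 hQ0
  have hs1 : s < 1 := (div_lt_one hQ0).2 hr
  have hbound : ∀ t M, 1 ≤ M → failureProb (C t) y π q M (dec t M) ≤ M * (K * s ^ d t) := by
    intro t M hM
    refine (hdec t M hM _ (hdle t)).trans ?_
    have h1 : r = Q * s := by rw [hs]; field_simp
    calc (M : ℝ) * n t * (K * r ^ d t) = (M * (K * s ^ d t)) * (n t * Q ^ d t) := by
          rw [h1, mul_pow]; ring
      _ ≤ (M * (K * s ^ d t)) * 1 := mul_le_mul_of_nonneg_left
          (natCast_mul_exp_pow_le_one hD (hdlog t)) (by positivity)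
      _ = _ := mul_one _
  have hdlim : Tendsto d atTop atTop := by
    rw [← tendsto_natCast_atTop_iff (R := ℝ)]
    exact tendsto_atTop_mono hdlog (Tendsto.const_mul_atTop hD
      (Real.tendsto_log_atTop.comp (tendsto_natCast_atTop_atTop.comp hn)))
  refine ⟨dec, ⟨fun t => K * s ^ d t, ?_, hbound⟩, fun c M hM => ?_⟩
  · simpa using ((tendsto_pow_atTop_nhds_zero_of_lt_one hs0.le hs1).comp hdlim).const_mul K
  · refine squeeze_zero (g := fun t => c * K * (d t * s ^ d t))
      (fun t => failureProb_nonneg _ hy hq hπ _ _) (fun t => ?_) ?_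
    · rcases hdtop t with htop | heq
      · have h0 : failureProb (C t) y π q (M t) (dec t (M t)) ≤ 0 := by
          have hr1 : r < 1 := hr.trans_le (Real.exp_le_one_iff.2
            (div_nonpos_of_nonpos_of_nonneg (by norm_num) hD.le))
          refine ge_of_tendsto' (f := fun d : ℕ => (M t : ℝ) * n t * (K * r ^ d)) (x := atTop) ?_
            fun d => hdec t (M t) (hM t).1 d (by simp [htop])
          simpa using ((tendsto_pow_atTop_nhds_zero_of_lt_one hr0.le hr1).const_mul K).const_mul
            ((M t : ℝ) * n t)
        exact h0.trans (by positivity)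
      · have h1 : M t ≤ c * d t := by
          have := (hM t).2
          rw [heq] at this
          exact_mod_cast this
        have h2 : (M t : ℝ) ≤ c * d t := by exact_mod_cast h1
        calc _ ≤ (M t : ℝ) * (K * s ^ d t) := hbound t (M t) (hM t).1
          _ ≤ (c * d t) * (K * s ^ d t) := mul_le_mul_of_nonneg_right h2 (by positivity)
          _ = _ := by ring
    · simpa using ((tendsto_self_mul_const_pow_of_lt_one hs0.le hs1).comp hdlim).const_mul (c * K)

theorem le_hammingNorm_of_le_distance {n : ℕ} {ι : Type} {C : StabilizerCode n ι} {d : ℕ}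
    (hd : (d : ℕ∞) ≤ C.distance) {e : PauliString n} (he : e ∉ C.stabilizer)
    (hs : C.syndrome e = 0) : d ≤ hammingNorm e := by
  have : C.distance ≤ (pauliWeight e : ℕ∞) := iInf₂_le (α := ℕ∞) e ⟨hs, he⟩
  exact_mod_cast hd.trans this

/-- A positive lower bound, below `Q`, of the positive numbers in a finite family. -/
theorem exists_pos_lt_of_nonneg {I : Type*} [Finite I] {x : I → ℝ} (hx : ∀ i, 0 ≤ x i) {Q : ℝ}
    (hQ : 0 < Q) : ∃ η, 0 < η ∧ η < Q ∧ ∀ i, x i = 0 ∨ η ≤ x i := by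
  have hall : ∀ i, ∀ᶠ η in 𝓝[>] (0 : ℝ), x i = 0 ∨ η ≤ x i := by
    intro i
    rcases (hx i).eq_or_lt with h | h
    · exact Eventually.of_forall fun _ => Or.inl h.symm
    · filter_upwards [mem_nhdsWithin_of_mem_nhds (Iio_mem_nhds h)] with η hη
      exact Or.inr (le_of_lt hη)
  have h : ∀ᶠ η in 𝓝[>] (0 : ℝ), 0 < η ∧ η < Q ∧ ∀ i, x i = 0 ∨ η ≤ x i := by
    filter_upwards [self_mem_nhdsWithin, mem_nhdsWithin_of_mem_nhds (Iio_mem_nhds hQ),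
      eventually_all.2 hall] with η h1 h2 h3
    exact ⟨h1, h2, h3⟩
  exact h.exists

theorem exp_neg_one_div_le_one {D : ℝ} (hD : 0 < D) : Real.exp (-1 / D) ≤ 1 :=
  Real.exp_le_one_iff.2 (div_nonpos_of_nonpos_of_nonneg (by norm_num) hD.le)

/-! ### Erasures with depolarizing errors -/

theorem overlap_const {B : Type*} [Fintype B] [Add B] {c : ℝ} (hc : 0 ≤ c) (g : B) :
    overlap (fun _ => c) g = Fintype.card B * c := by
  simp [overlap, Real.sqrt_mul_self hc]

theorem overlap_const_mul {B : Type*} [Fintype B] [Add B] {c : ℝ} (hc : 0 ≤ c) (ρ : B → ℝ)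
    (g : B) : overlap (fun a => c * ρ a) g = c * overlap ρ g := by
  rw [overlap, overlap, Finset.mul_sum]
  refine Finset.sum_congr rfl fun a _ => ?_
  rw [mul_mul_mul_comm, Real.sqrt_mul (mul_self_nonneg c), Real.sqrt_mul_self hc]

theorem depolarizing_nonneg {p : ℝ} (hp : p ∈ Set.Icc (0 : ℝ) 1) (e : ZMod 2 × ZMod 2) :
    0 ≤ depolarizing p e := by
  unfold depolarizing
  split_ifs
  · linarith [hp.2]
  · linarith [hp.1]

theorem sum_pauli (f : ZMod 2 × ZMod 2 → ℝ) :
    ∑ e, f e = f (0, 0) + f (0, 1) + f (1, 0) + f (1, 1) := by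
  rw [Fintype.sum_prod_type]
  simp only [sum_zmod_two]
  ring

theorem sum_depolarizing (p : ℝ) : ∑ e, depolarizing p e = 1 := by
  rw [sum_pauli]
  simp only [depolarizing, Prod.mk_eq_zero, one_ne_zero, and_false, false_and, and_self, if_true,
    if_false]
  ring

/-- Translation by `g` swaps the identity with `g`, giving two terms `√(p / 3 * (1 - p))`, and swaps
the other two Pauli operators, giving two terms `p / 3`. -/
theorem overlap_depolarizing {p : ℝ} (hp : p ∈ Set.Icc (0 : ℝ) 1) {g : ZMod 2 × ZMod 2}
    (hg : g ≠ 0) : overlap (depolarizing p) g = 2 * p / 3 + 2 * √(p / 3 * (1 - p)) := by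
  have h3 : 0 ≤ p / 3 := by linarith [hp.1]
  have h11 : (1 + 1 : ZMod 2) = 0 := rfl
  have hg' : g = (0, 1) ∨ g = (1, 0) ∨ g = (1, 1) := by revert g; decide
  rw [overlap, sum_pauli]
  rcases hg' with rfl | rfl | rfl <;>
  · simp only [depolarizing, Prod.mk_add_mk, Prod.mk_eq_zero, one_ne_zero, and_false, false_and,
      and_self, if_true, if_false, h11, zero_add, add_zero, Real.sqrt_mul_self h3,
      mul_comm (1 - p)]
    ring

/-- An erased qubit carries a uniform error, which translation does not change, so erasures
contribute their full probability. -/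
theorem sum_overlap_qubitProb {y : ℝ} (hy : y ∈ Set.Icc (0 : ℝ) 1) (π : ZMod 2 × ZMod 2 → ℝ)
    (g : ZMod 2 × ZMod 2) :
    ∑ b, overlap (fun a => qubitProb y π (b, a)) g = y + (1 - y) * overlap π g := by
  rw [Fintype.sum_bool, ← overlap_const_mul (sub_nonneg.2 hy.2)]
  simp only [qubitProb, if_true, Bool.false_eq_true, if_false]
  rw [overlap_const (by linarith [hy.1])]
  simp only [Fintype.card_prod, ZMod.card]
  push_cast
  ring

theorem sum_qubitProb (y : ℝ) {π : ZMod 2 × ZMod 2 → ℝ} (hπ : ∑ e, π e = 1) :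
    ∑ x, qubitProb y π x = 1 := by
  rw [Fintype.sum_prod_type, Fintype.sum_bool]
  simp only [qubitProb, if_true, Bool.false_eq_true, if_false, ← Finset.mul_sum, hπ,
    Finset.sum_const, Finset.card_univ, Fintype.card_prod, ZMod.card]
  norm_num

theorem Upsilon_nonneg {y p : ℝ} (hy : y ∈ Set.Icc (0 : ℝ) 1) (hp : p ∈ Set.Icc (0 : ℝ) 1) :
    0 ≤ Upsilon y p := by
  have h1 := hy.1
  have h2 := sub_nonneg.2 hy.2
  have h3 := hp.1
  unfold Upsilon
  positivity

theorem UpsilonCSS_nonneg {y p : ℝ} (hy : y ∈ Set.Icc (0 : ℝ) 1) : 0 ≤ UpsilonCSS y p := by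
  have h1 := hy.1
  have h2 := sub_nonneg.2 hy.2
  unfold UpsilonCSS
  positivity

/-- The commutation bit with a generator at one qubit. -/
def commHom (g : ZMod 2 × ZMod 2) : ZMod 2 × ZMod 2 →+ ZMod 2 where
  toFun a := g.1 * a.2 + g.2 * a.1
  map_zero' := by simp
  map_add' a b := by simp only [Prod.fst_add, Prod.snd_add]; ring

/-- Two of the three nontrivial Pauli operators anticommute with a given nontrivial one; this is the
factor 2 in `2 * w * Upsilon y p`. -/
theorem card_commHom_ne_zero_le {n : ℕ} (E : PauliString n) :
    (Finset.univ.filter fun y : Fin n × (ZMod 2 × ZMod 2) => commHom (E y.1) y.2 ≠ 0).card ≤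
      2 * pauliWeight E := by
  have h : ∀ g : ZMod 2 × ZMod 2,
      (∑ a : ZMod 2 × ZMod 2, if g.1 * a.2 + g.2 * a.1 ≠ 0 then 1 else 0) ≤
        2 * if g ≠ 0 then 1 else 0 := by decide
  rw [Finset.card_filter, Fintype.sum_prod_type, pauliWeight, hammingNorm, Finset.card_filter,
    Finset.mul_sum]
  exact Finset.sum_le_sum fun k _ => h (E k)

theorem measuredSyndromes_apply {n M : ℕ} {ι : Type} (C : StabilizerCode n ι)
    (h : QubitHistory n M) (ε : Fin (M - 1) → ι → ZMod 2) :
    measuredSyndromes C h ε = fun i j =>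
      ∑ k, commHom (C.gen j k) (∑ i' ∈ Finset.Iic i, (h i' k).2) +
        (if hi : (i : ℕ) < M - 1 then ε ⟨i, hi⟩ j else 0) := by
  ext i j
  simp only [measuredSyndromes, Pi.add_apply]
  congr 1
  · simp only [StabilizerCode.syndrome, commBit, Finset.sum_apply]
    rfl
  · split_ifs <;> rfl

theorem netError_eq {n M : ℕ} (h : QubitHistory n M) :
    netError h = fun k => ∑ i, (h i k).2 := by
  ext1 k
  simp [netError, roundError]

open Classical in
theorem failureProb_eq {n M : ℕ} {ι : Type} [Fintype ι] [DecidableEq ι] (C : StabilizerCode n ι)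
    (y : ℝ) (π : ZMod 2 × ZMod 2 → ℝ) (q : ℝ) (dec : Decoder n ι M) :
    failureProb C y π q M dec =
      ∑ h : Fin M → Fin n → Bool × (ZMod 2 × ZMod 2), ∑ ε : Fin (M - 1) → ι → ZMod 2,
        (∏ i, ∏ k, qubitProb y π (h i k)) * (∏ i, ∏ j, flipProb q (ε i j)) *
          (if dec (fun i k => (h i k).1) (fun i j =>
              ∑ k, commHom (C.gen j k) (∑ i' ∈ Finset.Iic i, (h i' k).2) +
                (if hi : (i : ℕ) < M - 1 then ε ⟨i, hi⟩ j else 0)) +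
              (fun k => ∑ i, (h i k).2) ∈ C.stabilizer then 0 else 1) := by
  simp only [failureProb, measuredSyndromes_apply, netError_eq]
  rfl

theorem exists_decoder_depolarizing {n r M : ℕ} (C : StabilizerCode n (Fin r)) {y p q Q η : ℝ}
    {w : ℕ} (hy : y ∈ Set.Icc (0 : ℝ) 1) (hp : p ∈ Set.Icc (0 : ℝ) 1)
    (hq : q ∈ Set.Icc (0 : ℝ) 1) (hw : ∀ j, pauliWeight (C.gen j) ≤ w)
    (hη : Upsilon y p = 0 ∨ η ≤ Upsilon y p)
    (hη' : 2 * √(q * (1 - q)) = 0 ∨ η ≤ 2 * √(q * (1 - q))) (hη0 : 0 < η) (hηQ : η < Q)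
    (hQ1 : Q ≤ 1) (hQ : 4 * √(q * (1 - q)) + 2 * w * Upsilon y p ≤ Q) (hM : 1 ≤ M) :
    ∃ dec : Decoder n (Fin r) M, ∀ d : ℕ, (d : ℕ∞) ≤ C.distance →
      failureProb C y (depolarizing p) q M dec ≤
        M * n * (4 * Upsilon y p / ((Q - η) * (1 - (Q - η))) * (Q - η) ^ d) := by
  have hΥ := Upsilon_nonneg hy hp
  obtain ⟨dec, hdec⟩ := exists_spacetime_decoder (M := M) (fun j k => commHom (C.gen j k))
    C.stabilizer (qubitProb_nonneg hy (depolarizing_nonneg hp))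
    (sum_qubitProb y (sum_depolarizing p)) hq
    (fun g hg => by rw [sum_overlap_qubitProb hy, overlap_depolarizing hp hg]; rfl)
    hΥ hη hη' hη0 hηQ hQ1
    (fun j => by
      refine le_trans (add_le_add le_rfl (mul_le_mul_of_nonneg_right ?_ hΥ)) hQ
      exact_mod_cast (card_commHom_ne_zero_le (C.gen j)).trans (Nat.mul_le_mul le_rfl (hw j))) hM
  refine ⟨dec, fun d hd => ?_⟩
  have h := hdec d fun e he hs => le_hammingNorm_of_le_distance hd he (funext hs)
  rw [failureProb_eq]
  refine h.trans (le_of_eq ?_)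
  rw [Fintype.card_prod, ZMod.card]
  push_cast
  ring

/-! ### Marginals of independent errors -/

section Marginal

variable {I K Ω B C : Type*} [Fintype I] [DecidableEq I] [Fintype K] [DecidableEq K] [Fintype Ω]
  [Fintype B] [Fintype C]

theorem sum_prod_marginal (E : Ω ≃ B × C) (ρ : Ω → ℝ) (F : (I → B) → ℝ) :
    ∑ h : I → Ω, (∏ i, ρ (h i)) * F (fun i => (E (h i)).1) =
      ∑ b : I → B, (∏ i, ∑ c, ρ (E.symm (b i, c))) * F b := by
  simp_rw [Finset.prod_univ_sum, Fintype.piFinset_univ, Finset.sum_mul]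
  rw [← Fintype.sum_prod_type']
  exact Fintype.sum_equiv
    { toFun := fun h => (fun i => (E (h i)).1, fun i => (E (h i)).2)
      invFun := fun x i => E.symm (x.1 i, x.2 i)
      left_inv := fun h => by simp
      right_inv := fun x => by simp } _ _ fun h => by simp

theorem sum_prod_prod_marginal (E : Ω ≃ B × C) (ρ : Ω → ℝ) (F : (I → K → B) → ℝ) :
    ∑ h : I → K → Ω, (∏ i, ∏ k, ρ (h i k)) * F (fun i k => (E (h i k)).1) =
      ∑ b : I → K → B, (∏ i, ∏ k, ∑ c, ρ (E.symm (b i k, c))) * F b := by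
  simp_rw [Finset.prod_univ_sum (fun _ => Finset.univ), Fintype.piFinset_univ]
  -- The one-index statement is applied with whole rows `K → Ω` as letters.
  exact sum_prod_marginal
    { toFun := fun h => (fun k => (E (h k)).1, fun k => (E (h k)).2)
      invFun := fun x k => E.symm (x.1 k, x.2 k)
      left_inv := fun h => by simp
      right_inv := fun x => by simp } (fun h : K → Ω => ∏ k, ρ (h k)) F

theorem sum_flipProb_marginal {κ κ₁ κ₂ : Type*} [Fintype κ] [Fintype κ₁] [Fintype κ₂]
    [DecidableEq κ] [DecidableEq κ₁] [DecidableEq κ₂] (S : κ₁ ⊕ κ₂ ≃ κ) (q : ℝ)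
    (F : (I → κ₁ → ZMod 2) → ℝ) :
    ∑ ε : I → κ → ZMod 2, (∏ i, ∏ j, flipProb q (ε i j)) * F (fun i j => ε i (S (.inl j))) =
      ∑ ε : I → κ₁ → ZMod 2, (∏ i, ∏ j, flipProb q (ε i j)) * F ε := by
  have h := sum_prod_marginal (I := I)
    ((Equiv.arrowCongr S.symm (Equiv.refl (ZMod 2))).trans (Equiv.sumArrowEquivProdArrow _ _ _))
    (fun x => ∏ j, flipProb q (x j)) F
  refine h.trans (Finset.sum_congr rfl fun b _ => ?_)
  congr 1
  refine Finset.prod_congr rfl fun i _ => ?_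
  have h1 : ∀ c : κ₂ → ZMod 2, ∏ j, flipProb q
      (((Equiv.arrowCongr S.symm (Equiv.refl (ZMod 2))).trans
        (Equiv.sumArrowEquivProdArrow κ₁ κ₂ (ZMod 2))).symm (b i, c) j) =
      (∏ j, flipProb q (b i j)) * ∏ j, flipProb q (c j) := by
    intro c
    rw [← S.prod_comp, Fintype.prod_sum_type]
    simp
  simp_rw [h1]
  rw [← Finset.mul_sum]
  have h2 := Finset.prod_univ_sum (fun _ : κ₂ => (Finset.univ : Finset (ZMod 2)))
    (fun _ => flipProb q)
  rw [Fintype.piFinset_univ] at h2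
  rw [← h2]
  simp [sum_flipProb]

end Marginal

/-! ### Decoding one type of bit errors -/

/-- One bit in one round, with the same conventions as in `qubitProb`. -/
noncomputable def bitProb (y p : ℝ) (a : Bool × ZMod 2) : ℝ :=
  if a.1 = true then y * (1 / 2) else (1 - y) * flipProb p a.2

theorem bitProb_nonneg {y p : ℝ} (hy : y ∈ Set.Icc (0 : ℝ) 1) (hp : p ∈ Set.Icc (0 : ℝ) 1)
    (a : Bool × ZMod 2) : 0 ≤ bitProb y p a := by
  unfold bitProb
  split_ifs
  · linarith [hy.1]
  · exact mul_nonneg (sub_nonneg.2 hy.2) (flipProb_nonneg hp _)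

theorem sum_bitProb (y p : ℝ) : ∑ x, bitProb y p x = 1 := by
  rw [Fintype.sum_prod_type, Fintype.sum_bool]
  simp only [bitProb, if_true, Bool.false_eq_true, if_false, ← Finset.mul_sum, sum_flipProb,
    Finset.sum_const, Finset.card_univ, ZMod.card]
  norm_num

theorem sum_overlap_bitProb {y : ℝ} (hy : y ∈ Set.Icc (0 : ℝ) 1) (p : ℝ) {g : ZMod 2}
    (hg : g ≠ 0) : ∑ b, overlap (fun a => bitProb y p (b, a)) g = UpsilonCSS y p := by
  rw [Fintype.sum_bool]
  simp only [bitProb, if_true, Bool.false_eq_true, if_false]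
  rw [overlap_const_mul (sub_nonneg.2 hy.2), overlap_flipProb p hg,
    overlap_const (by linarith [hy.1]), ZMod.card, UpsilonCSS]
  push_cast
  ring

/-- A bit has only one nonzero error, so the factor 2 of the Pauli case is absent. -/
theorem card_mulLeft_ne_zero {n : ℕ} (g : Fin n → ZMod 2) :
    (Finset.univ.filter fun y : Fin n × ZMod 2 => AddMonoidHom.mulLeft (g y.1) y.2 ≠ 0).card =
      hammingNorm g := by
  have h : ∀ g : ZMod 2, (∑ a : ZMod 2, if g * a ≠ 0 then 1 else 0) = if g ≠ 0 then 1 else 0 := by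
    decide
  rw [Finset.card_filter, Fintype.sum_prod_type, hammingNorm, Finset.card_filter]
  exact Finset.sum_congr rfl fun k _ => h (g k)

open Classical in
/-- The failure indicator for bit errors that are detected by the checks `H`, where errors in `T`
are harmless. -/
noncomputable def bitFailure {n M : ℕ} {κ : Type} (H : κ → Fin n → ZMod 2)
    (T : AddSubgroup (Fin n → ZMod 2))
    (dec : (Fin M → Fin n → Bool) → (Fin M → κ → ZMod 2) → Fin n → ZMod 2)
    (h : Fin M → Fin n → Bool × ZMod 2) (ε : Fin (M - 1) → κ → ZMod 2) : ℝ :=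
  if dec (fun i k => (h i k).1) (fun i j =>
      ∑ k, AddMonoidHom.mulLeft (H j k) (∑ i' ∈ Finset.Iic i, (h i' k).2) +
        (if hi : (i : ℕ) < M - 1 then ε ⟨i, hi⟩ j else 0)) +
      (fun k => ∑ i, (h i k).2) ∈ T then 0 else 1

theorem exists_bit_decoder {n M : ℕ} {κ : Type} [Fintype κ] [DecidableEq κ]
    (H : κ → Fin n → ZMod 2) (T : AddSubgroup (Fin n → ZMod 2)) {y p q Q η : ℝ}
    {w : ℕ} (hy : y ∈ Set.Icc (0 : ℝ) 1) (hp : p ∈ Set.Icc (0 : ℝ) 1)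
    (hq : q ∈ Set.Icc (0 : ℝ) 1) (hw : ∀ j, hammingNorm (H j) ≤ w)
    (hη : UpsilonCSS y p = 0 ∨ η ≤ UpsilonCSS y p)
    (hη' : 2 * √(q * (1 - q)) = 0 ∨ η ≤ 2 * √(q * (1 - q))) (hη0 : 0 < η) (hηQ : η < Q)
    (hQ1 : Q ≤ 1) (hQ : 4 * √(q * (1 - q)) + w * UpsilonCSS y p ≤ Q) (hM : 1 ≤ M) :
    ∃ dec : (Fin M → Fin n → Bool) → (Fin M → κ → ZMod 2) → Fin n → ZMod 2,
      ∀ d : ℕ, (∀ e ∉ T, (∀ j, ∑ k, H j k * e k = 0) → d ≤ hammingNorm e) →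
        ∑ h : Fin M → Fin n → Bool × ZMod 2, ∑ ε : Fin (M - 1) → κ → ZMod 2,
          (∏ i, ∏ k, bitProb y p (h i k)) * (∏ i, ∏ j, flipProb q (ε i j)) *
            bitFailure H T dec h ε ≤
        M * n * (2 * UpsilonCSS y p / ((Q - η) * (1 - (Q - η))) * (Q - η) ^ d) := by
  have hΥ := UpsilonCSS_nonneg (p := p) hy
  obtain ⟨dec, hdec⟩ := exists_spacetime_decoder (M := M)
    (fun j k => AddMonoidHom.mulLeft (H j k)) T (bitProb_nonneg hy hp) (sum_bitProb y p) hq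
    (fun g hg => sum_overlap_bitProb hy p hg) hΥ hη hη' hη0 hηQ hQ1
    (fun j => by
      refine le_trans (add_le_add le_rfl (mul_le_mul_of_nonneg_right ?_ hΥ)) hQ
      exact_mod_cast (card_mulLeft_ne_zero (H j)).trans_le (hw j)) hM
  refine ⟨dec, fun d hd => (hdec d hd).trans (le_of_eq ?_)⟩
  rw [ZMod.card]
  push_cast
  ring

/-- Summing over the irrelevant bits and checks, where `σ` splits the Pauli error into the relevant
bit and the other one. -/
theorem sum_bitFailure_eq {n M : ℕ} {κ κ₁ κ₂ : Type} [Fintype κ] [Fintype κ₁] [Fintype κ₂]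
    [DecidableEq κ] [DecidableEq κ₁] [DecidableEq κ₂] (S : κ₁ ⊕ κ₂ ≃ κ) {y p q : ℝ}
    {π : ZMod 2 × ZMod 2 → ℝ} (σ : ZMod 2 × ZMod 2 ≃ ZMod 2 × ZMod 2)
    (hπ : ∀ b, ∑ c, π (σ.symm (b, c)) = flipProb p b)
    (F : (Fin M → Fin n → Bool × ZMod 2) → (Fin (M - 1) → κ₁ → ZMod 2) → ℝ) :
    ∑ h : Fin M → Fin n → Bool × (ZMod 2 × ZMod 2), ∑ ε : Fin (M - 1) → κ → ZMod 2,
      (∏ i, ∏ k, qubitProb y π (h i k)) * (∏ i, ∏ j, flipProb q (ε i j)) *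
        F (fun i k => ((h i k).1, (σ (h i k).2).1)) (fun i j => ε i (S (.inl j))) =
    ∑ h : Fin M → Fin n → Bool × ZMod 2, ∑ ε : Fin (M - 1) → κ₁ → ZMod 2,
      (∏ i, ∏ k, bitProb y p (h i k)) * (∏ i, ∏ j, flipProb q (ε i j)) * F h ε := by
  let E : Bool × (ZMod 2 × ZMod 2) ≃ (Bool × ZMod 2) × ZMod 2 :=
    ((Equiv.refl Bool).prodCongr σ).trans (Equiv.prodAssoc _ _ _).symm
  have hE : ∀ x, ∑ c, qubitProb y π (E.symm (x, c)) = bitProb y p x := by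
    rintro ⟨b, v⟩
    cases b
    · have h1 : ∀ c, qubitProb y π (E.symm ((false, v), c)) = (1 - y) * π (σ.symm (v, c)) :=
        fun c => by simp [qubitProb, E]
      simp_rw [h1, ← Finset.mul_sum, hπ]
      simp [bitProb]
    -- Two of the four equally likely errors of an erased qubit have a given relevant bit, whence
    -- the `1 / 2` in `bitProb`.
    · have h1 : ∀ c, qubitProb y π (E.symm ((true, v), c)) = y * (1 / 4) :=
        fun c => by simp [qubitProb, E]
      simp_rw [h1]
      simp only [bitProb, if_true, Finset.sum_const, Finset.card_univ, ZMod.card]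
      norm_num
      ring
  have h := sum_prod_prod_marginal (I := Fin M) (K := Fin n) E (qubitProb y π)
    (fun h => ∑ ε : Fin (M - 1) → κ₁ → ZMod 2, (∏ i, ∏ j, flipProb q (ε i j)) * F h ε)
  simp_rw [hE] at h
  simp_rw [mul_assoc, ← Finset.mul_sum]
  rw [← h]
  exact Finset.sum_congr rfl fun x _ => congrArg _ (sum_flipProb_marginal S q (F _))

/-! ### CSS codes: separate decoding of `X` and `Z` errors -/

section CSS

variable {n rX rZ M : ℕ}

/-- A product of `X` operators. -/
def pauliX (n : ℕ) : (Fin n → ZMod 2) →+ PauliString n where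
  toFun x := fun k => (x k, 0)
  map_zero' := rfl
  map_add' x x' := by ext k <;> simp

/-- A product of `Z` operators. -/
def pauliZ (n : ℕ) : (Fin n → ZMod 2) →+ PauliString n where
  toFun x := fun k => (0, x k)
  map_zero' := rfl
  map_add' x x' := by ext k <;> simp

/-- The `X` part of a Pauli operator. -/
def xPart (n : ℕ) : PauliString n →+ (Fin n → ZMod 2) where
  toFun e := fun k => (e k).1
  map_zero' := rfl
  map_add' _ _ := rfl

/-- The `Z` part of a Pauli operator. -/
def zPart (n : ℕ) : PauliString n →+ (Fin n → ZMod 2) where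
  toFun e := fun k => (e k).2
  map_zero' := rfl
  map_add' _ _ := rfl

namespace CSSCode

theorem mem_stabilizer_iff (C : CSSCode n rX rZ) (e : PauliString n) :
    e ∈ C.toStabilizerCode.stabilizer ↔
      xPart n e ∈ AddSubgroup.closure (Set.range C.genX) ∧
        zPart n e ∈ AddSubgroup.closure (Set.range C.genZ) := by
  constructor
  · intro he
    have hX : C.toStabilizerCode.stabilizer ≤
        (AddSubgroup.closure (Set.range C.genX)).comap (xPart n) := by
      refine (AddSubgroup.closure_le _).2 ?_
      rintro _ ⟨i | j, rfl⟩
      · exact AddSubgroup.subset_closure ⟨i, rfl⟩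
      · exact zero_mem (AddSubgroup.closure (Set.range C.genX))
    have hZ : C.toStabilizerCode.stabilizer ≤
        (AddSubgroup.closure (Set.range C.genZ)).comap (zPart n) := by
      refine (AddSubgroup.closure_le _).2 ?_
      rintro _ ⟨i | j, rfl⟩
      · exact zero_mem (AddSubgroup.closure (Set.range C.genZ))
      · exact AddSubgroup.subset_closure ⟨j, rfl⟩
    exact ⟨hX he, hZ he⟩
  · rintro ⟨hx, hz⟩
    have hX : AddSubgroup.closure (Set.range C.genX) ≤
        C.toStabilizerCode.stabilizer.comap (pauliX n) := by
      refine (AddSubgroup.closure_le _).2 ?_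
      rintro _ ⟨i, rfl⟩
      exact AddSubgroup.subset_closure ⟨Sum.inl i, rfl⟩
    have hZ : AddSubgroup.closure (Set.range C.genZ) ≤
        C.toStabilizerCode.stabilizer.comap (pauliZ n) := by
      refine (AddSubgroup.closure_le _).2 ?_
      rintro _ ⟨j, rfl⟩
      exact AddSubgroup.subset_closure ⟨Sum.inr j, rfl⟩
    have : e = pauliX n (xPart n e) + pauliZ n (zPart n e) := by
      ext k <;> simp [pauliX, pauliZ, xPart, zPart]
    rw [this]
    exact add_mem (hX hx) (hZ hz)

theorem le_hammingNorm_of_X (C : CSSCode n rX rZ) {d : ℕ}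
    (hd : (d : ℕ∞) ≤ C.toStabilizerCode.distance) (x : Fin n → ZMod 2)
    (hx : x ∉ AddSubgroup.closure (Set.range C.genX))
    (hs : ∀ j, ∑ k, C.genZ j k * x k = 0) : d ≤ hammingNorm x := by
  have h := le_hammingNorm_of_le_distance hd (e := pauliX n x)
    (fun h => hx ((C.mem_stabilizer_iff _).1 h).1) (by
      ext (i | j)
      · simp [StabilizerCode.syndrome, commBit, toStabilizerCode, pauliX]
      · simpa [StabilizerCode.syndrome, commBit, toStabilizerCode, pauliX] using hs j)
  simpa [hammingNorm, pauliX, Prod.ext_iff] using h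

theorem le_hammingNorm_of_Z (C : CSSCode n rX rZ) {d : ℕ}
    (hd : (d : ℕ∞) ≤ C.toStabilizerCode.distance) (x : Fin n → ZMod 2)
    (hx : x ∉ AddSubgroup.closure (Set.range C.genZ))
    (hs : ∀ j, ∑ k, C.genX j k * x k = 0) : d ≤ hammingNorm x := by
  have h := le_hammingNorm_of_le_distance hd (e := pauliZ n x)
    (fun h => hx ((C.mem_stabilizer_iff _).1 h).2) (by
      ext (i | j)
      · simpa [StabilizerCode.syndrome, commBit, toStabilizerCode, pauliZ] using hs i
      · simp [StabilizerCode.syndrome, commBit, toStabilizerCode, pauliZ])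
  simpa [hammingNorm, pauliZ, Prod.ext_iff] using h

/-- Decoding the `X` errors and the `Z` errors of a CSS code separately. -/
def combinedDecoder
    (decX : (Fin M → Fin n → Bool) → (Fin M → Fin rZ → ZMod 2) → Fin n → ZMod 2)
    (decZ : (Fin M → Fin n → Bool) → (Fin M → Fin rX → ZMod 2) → Fin n → ZMod 2) :
    Decoder n (Fin rX ⊕ Fin rZ) M :=
  fun b s k => (decX b (fun i j => s i (.inr j)) k, decZ b (fun i j => s i (.inl j)) k)

open Classical in
-- Stabilizer membership splits into the `X` part and the `Z` part, and `X` errors are seen by the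
-- `Z`-type generators only and vice versa. So a failure is a failure of one of the two bit
-- decoders.
theorem failure_combinedDecoder_le (C : CSSCode n rX rZ)
    (decX : (Fin M → Fin n → Bool) → (Fin M → Fin rZ → ZMod 2) → Fin n → ZMod 2)
    (decZ : (Fin M → Fin n → Bool) → (Fin M → Fin rX → ZMod 2) → Fin n → ZMod 2)
    (h : Fin M → Fin n → Bool × (ZMod 2 × ZMod 2))
    (ε : Fin (M - 1) → Fin rX ⊕ Fin rZ → ZMod 2) :
    (if combinedDecoder decX decZ (fun i k => (h i k).1) (fun i j =>
        ∑ k, commHom (C.toStabilizerCode.gen j k) (∑ i' ∈ Finset.Iic i, (h i' k).2) +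
          (if hi : (i : ℕ) < M - 1 then ε ⟨i, hi⟩ j else 0)) +
        (fun k => ∑ i, (h i k).2) ∈ C.toStabilizerCode.stabilizer then 0 else 1 : ℝ) ≤
      bitFailure C.genZ (AddSubgroup.closure (Set.range C.genX)) decX
        (fun i k => ((h i k).1, (h i k).2.1)) (fun i j => ε i (.inr j)) +
      bitFailure C.genX (AddSubgroup.closure (Set.range C.genZ)) decZ
        (fun i k => ((h i k).1, (h i k).2.2)) (fun i j => ε i (.inl j)) := by
  have hsX : ∀ (j : Fin rZ) (e : PauliString n),
      ∑ k, commHom (C.toStabilizerCode.gen (.inr j) k) (e k) =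
        ∑ k, AddMonoidHom.mulLeft (C.genZ j k) (e k).1 := fun j e =>
    Finset.sum_congr rfl fun k _ => by simp [commHom, toStabilizerCode]
  have hsZ : ∀ (j : Fin rX) (e : PauliString n),
      ∑ k, commHom (C.toStabilizerCode.gen (.inl j) k) (e k) =
        ∑ k, AddMonoidHom.mulLeft (C.genX j k) (e k).2 := fun j e =>
    Finset.sum_congr rfl fun k _ => by simp [commHom, toStabilizerCode]
  have hX := fun (j : Fin rZ) (i : Fin M) => hsX j fun k => ∑ i' ∈ Finset.Iic i, (h i' k).2
  have hZ := fun (j : Fin rX) (i : Fin M) => hsZ j fun k => ∑ i' ∈ Finset.Iic i, (h i' k).2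
  simp only [Prod.fst_sum] at hX
  simp only [Prod.snd_sum] at hZ
  have hnX : xPart n (fun k => ∑ i, (h i k).2) = fun k => ∑ i, (h i k).2.1 := by
    ext k; simp [xPart, Prod.fst_sum]
  have hnZ : zPart n (fun k => ∑ i, (h i k).2) = fun k => ∑ i, (h i k).2.2 := by
    ext k; simp [zPart, Prod.snd_sum]
  simp only [mem_stabilizer_iff, map_add, hnX, hnZ]
  have hdX : ∀ b s, xPart n (combinedDecoder decX decZ b s) =
      decX b (fun i j => s i (.inr j)) := fun _ _ => rfl
  have hdZ : ∀ b s, zPart n (combinedDecoder decX decZ b s) =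
      decZ b (fun i j => s i (.inl j)) := fun _ _ => rfl
  simp only [hdX, hdZ, hX, hZ, bitFailure]
  split_ifs <;> simp_all

end CSSCode

theorem sum_independentXZ_snd (pX pZ : ℝ) (b : ZMod 2) :
    ∑ c, independentXZ pX pZ (b, c) = flipProb pX b := by
  simp only [independentXZ, ← Finset.mul_sum, sum_flipProb, mul_one]

theorem sum_independentXZ_fst (pX pZ : ℝ) (b : ZMod 2) :
    ∑ c, independentXZ pX pZ (c, b) = flipProb pZ b := by
  simp only [independentXZ, ← Finset.sum_mul, sum_flipProb, one_mul]

/-- The two bit decoders share the erasures, but the union bound over their failures uses only the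
marginals of `X` and `Z` errors. -/
theorem exists_decoder_independentXZ (C : CSSCode n rX rZ) {y pX pZ q Q η : ℝ}
    {wX wZ : ℕ} (hy : y ∈ Set.Icc (0 : ℝ) 1) (hpX : pX ∈ Set.Icc (0 : ℝ) 1)
    (hpZ : pZ ∈ Set.Icc (0 : ℝ) 1) (hq : q ∈ Set.Icc (0 : ℝ) 1)
    (hwX : ∀ i, hammingNorm (C.genX i) ≤ wX) (hwZ : ∀ j, hammingNorm (C.genZ j) ≤ wZ)
    (hηX : UpsilonCSS y pX = 0 ∨ η ≤ UpsilonCSS y pX)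
    (hηZ : UpsilonCSS y pZ = 0 ∨ η ≤ UpsilonCSS y pZ)
    (hη' : 2 * √(q * (1 - q)) = 0 ∨ η ≤ 2 * √(q * (1 - q))) (hη0 : 0 < η) (hηQ : η < Q)
    (hQ1 : Q ≤ 1) (hQX : 4 * √(q * (1 - q)) + wX * UpsilonCSS y pZ ≤ Q)
    (hQZ : 4 * √(q * (1 - q)) + wZ * UpsilonCSS y pX ≤ Q) (hM : 1 ≤ M) :
    ∃ dec : Decoder n (Fin rX ⊕ Fin rZ) M, ∀ d : ℕ, (d : ℕ∞) ≤ C.toStabilizerCode.distance →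
      failureProb C.toStabilizerCode y (independentXZ pX pZ) q M dec ≤
        M * n * (2 * (UpsilonCSS y pX + UpsilonCSS y pZ) / ((Q - η) * (1 - (Q - η))) *
          (Q - η) ^ d) := by
  obtain ⟨decX, hdecX⟩ := exists_bit_decoder C.genZ (AddSubgroup.closure (Set.range C.genX))
    hy hpX hq hwZ hηX hη' hη0 hηQ hQ1 hQZ hM
  obtain ⟨decZ, hdecZ⟩ := exists_bit_decoder C.genX (AddSubgroup.closure (Set.range C.genZ))
    hy hpZ hq hwX hηZ hη' hη0 hηQ hQ1 hQX hM
  refine ⟨CSSCode.combinedDecoder decX decZ, fun d hd => ?_⟩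
  have hbX := hdecX d (C.le_hammingNorm_of_X hd)
  have hbZ := hdecZ d (C.le_hammingNorm_of_Z hd)
  -- For `X` errors the relevant checks are the `Z`-type generators, which `Equiv.sumComm` puts
  -- first; for `Z` errors it is the bits that are swapped.
  rw [← sum_bitFailure_eq (Equiv.sumComm (Fin rZ) (Fin rX)) (Equiv.refl _)
    (sum_independentXZ_snd pX pZ)] at hbX
  rw [← sum_bitFailure_eq (Equiv.refl (Fin rX ⊕ Fin rZ)) (Equiv.prodComm _ _)
    (sum_independentXZ_fst pX pZ)] at hbZ
  have hπ : ∀ e, 0 ≤ independentXZ pX pZ e := fun e =>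
    mul_nonneg (flipProb_nonneg hpX _) (flipProb_nonneg hpZ _)
  rw [failureProb_eq]
  refine (Finset.sum_le_sum fun h _ => Finset.sum_le_sum fun ε _ => mul_le_mul_of_nonneg_left
    (C.failure_combinedDecoder_le decX decZ h ε) (mul_nonneg
      (Finset.prod_nonneg fun i _ => Finset.prod_nonneg fun k _ => qubitProb_nonneg hy hπ _)
      (Finset.prod_nonneg fun i _ => Finset.prod_nonneg fun j _ => flipProb_nonneg hq _))).trans ?_
  simp only [mul_add, Finset.sum_add_distrib]
  refine (add_le_add hbX hbZ).trans (le_of_eq ?_)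
  ring

end CSS

/-! ### The thresholds -/

theorem theorem3 :
    -- (a) stabilizer codes, erasures and depolarizing errors
    (∀ (D y p q : ℝ) (w : ℕ) (n r : ℕ → ℕ) (C : ∀ t, StabilizerCode (n t) (Fin (r t))),
      0 < D → y ∈ Set.Icc (0 : ℝ) 1 → p ∈ Set.Icc (0 : ℝ) 1 → q ∈ Set.Icc (0 : ℝ) 1 →
      Tendsto n atTop atTop →
      (∀ t, ENNReal.ofReal (D * Real.log (n t)) ≤ ((C t).distance : ℝ≥0∞)) →
      (∀ t j, pauliWeight ((C t).gen j) ≤ w) →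
      4 * √(q * (1 - q)) + 2 * w * Upsilon y p ≤ Real.exp (-1 / D) →
      VanishingErrorRates C y (depolarizing p) q) ∧
    -- (b) CSS codes, erasures and independent X/Z errors
    (∀ (D y pX pZ q : ℝ) (wX wZ : ℕ) (n rX rZ : ℕ → ℕ)
      (C : ∀ t, CSSCode (n t) (rX t) (rZ t)),
      0 < D → y ∈ Set.Icc (0 : ℝ) 1 → pX ∈ Set.Icc (0 : ℝ) 1 → pZ ∈ Set.Icc (0 : ℝ) 1 →
      q ∈ Set.Icc (0 : ℝ) 1 →
      Tendsto n atTop atTop →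
      (∀ t, ENNReal.ofReal (D * Real.log (n t)) ≤
        ((C t).toStabilizerCode.distance : ℝ≥0∞)) →
      (∀ t i, hammingNorm ((C t).genX i) ≤ wX) →
      (∀ t j, hammingNorm ((C t).genZ j) ≤ wZ) →
      4 * √(q * (1 - q)) + wX * UpsilonCSS y pZ ≤ Real.exp (-1 / D) →
      4 * √(q * (1 - q)) + wZ * UpsilonCSS y pX ≤ Real.exp (-1 / D) →
      VanishingErrorRates (fun t => (C t).toStabilizerCode) y (independentXZ pX pZ) q) := by
  refine ⟨?_, ?_⟩
  · intro D y p q w n r C hD hy hp hq hn hdist hw hle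
    -- Here `Q = exp (-1 / D)`, and `η` lies below `Q` and does not exceed any nonzero Bhattacharyya
    -- parameter of a single-site error. The decay rate is `r = Q - η`, strictly below `exp (-1 /
    -- D)` even when the threshold condition is an equality.
    obtain ⟨η, hη0, hηQ, hη⟩ := exists_pos_lt_of_nonneg
      (x := ![Upsilon y p, 2 * √(q * (1 - q))])
      (by simp [Fin.forall_fin_two, Upsilon_nonneg hy hp]) (Real.exp_pos (-1 / D))
    have hQ1 := exp_neg_one_div_le_one hD
    have hr0 := sub_pos.2 hηQ
    refine vanishingErrorRates_of_failureProb_le C hy hq (depolarizing_nonneg hp) hD hn hdist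
      (div_nonneg (mul_nonneg (by norm_num) (Upsilon_nonneg hy hp))
        (mul_nonneg hr0.le (by linarith))) hr0 (by linarith)
      fun t M hM => exists_decoder_depolarizing (C t) hy hp hq (hw t) (hη 0) (hη 1) hη0 hηQ hQ1
        hle hM
  · intro D y pX pZ q wX wZ n rX rZ C hD hy hpX hpZ hq hn hdist hwX hwZ hleX hleZ
    have hX := UpsilonCSS_nonneg (p := pX) hy
    have hZ := UpsilonCSS_nonneg (p := pZ) hy
    obtain ⟨η, hη0, hηQ, hη⟩ := exists_pos_lt_of_nonneg
      (x := ![UpsilonCSS y pX, UpsilonCSS y pZ, 2 * √(q * (1 - q))])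
      (by simp [Fin.forall_fin_succ, hX, hZ]) (Real.exp_pos (-1 / D))
    have hQ1 := exp_neg_one_div_le_one hD
    have hr0 := sub_pos.2 hηQ
    refine vanishingErrorRates_of_failureProb_le (fun t => (C t).toStabilizerCode) hy hq
      (fun e => mul_nonneg (flipProb_nonneg hpX _) (flipProb_nonneg hpZ _)) hD hn hdist
      (div_nonneg (mul_nonneg (by norm_num) (add_nonneg hX hZ))
        (mul_nonneg hr0.le (by linarith))) hr0 (by linarith)
      fun t M hM => exists_decoder_independentXZ (C t) hy hpX hpZ hq (hwX t) (hwZ t) (hη 0) (hη 1)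
        (hη 2) hη0 hηQ hQ1 hleX hleZ hM
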